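/- Let $r\ge 1$ be an integer, $N=r+1$, and let $\hat\Pi_r$ be the projection of the Fock space of one bosonic mode (annihilation operator $\hat a$, $\hat n=\hat a^\dagger\hat a$) onto the span of $|0\rangle,\dots,|r\rangle$. Put $$\hat H_{c,R}=\hat\Pi_r\big[\hat a^\dagger(\hat n-r)+\text{h.c.}\big]\hat\Pi_r,\qquad \hat H_{c,I}=\hat\Pi_r\big[i\,\hat a^\dagger(\hat n-r)+\text{h.c.}\big]\hat\Pi_r,\qquad \hat H_{d,0}=\hat\Pi_r\big[\tfrac{\chi}{2}\hat a^{\dagger2}\hat a^2+\Delta_0\hat a^\dagger\hat a\big]\hat\Pi_r,$$ regarded as $N\times N$ matrices, with $\chi,\Delta_0\in\mathbb R$. Then: 1. $[i\hat H_{c,R},i\hat H_{c,I}]=\sum_{n=0}^r E_n\, i|n\rangle\langle n|$ with $E_n=-2[3n^2-(4r+1)n+r^2]$. This matrix is diagonal and traceless, and its levels are anharmonic: with $\mu_k=E_k-E_{k+1}$ for $0\le k\le N-2$, either $\mu_0\ne0$ and $\mu_k^2\neq\mu_0^2$ for all $k>0$, or $\mu_{N-2}\neq0$ and $\mu_k^2\ne\mu_{N-2}^2$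 for all $k<N-2$. 2. The real Lie algebra generated by $[i\hat H_{c,R},i\hat H_{c,I}]$ and $i\hat H_{c,R}$ is $\mathfrak{su}(N)$, and so is the real Lie algebra generated by $i\hat H_{c,R}$ and $i\hat H_{c,I}$. 3. Let $\chi\ne0$. For every $V\in SU(N)$ and every $T>0$ there is a smooth control $\alpha:\mathbb R\to\mathbb C$ such that the solution on $[0,T]$ of $\dot U(t)=-i\,\chi\big(\operatorname{Re}\alpha(t)\,\hat H_{c,R}+\operatorname{Im}\alpha(t)\,\hat H_{c,I}\big)U(t)$, $U(0)=1$, satisfies $U(T)=V$. 4. Let $\chi\neq0$ and $\Delta_0\in\mathbb R$. For every $V\in SU(N)$ there is a smooth $\alpha:\mathbb R\to\mathbb C$ such that the sped-up controls $\alpha_T(t)=T^{-1}\alpha(t/T)$, $T>0$, have the following two properties. Without drift, $\alpha_T$ steers $1$ to $V$ in time $T$, in the sense of 3, for every $T>0$. With the drift, the solution $W_T$ on $[0,T]$ of $\dot W_T(t)=-i\big[\hat H_{d,0}+\chi\operatorname{Re}\alpha_T(t)\,\hat H_{c,R}+\chi\operatorname{Im}\alpha_T(t)\,\hat H_{c,I}\big]W_T(t)$,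 $W_T(0)=1$, satisfies $W_T(T)\to V$ as $T\to0^+$. -/

import Mathlib

open scoped Matrix ContDiff Topology

attribute [local instance 100] LieRing.ofAssociativeRing

namespace KerrBlockade

/-! ### Fock space operators -/

/-- Finite superpositions of the Fock states `|0⟩, |1⟩, |2⟩, …` of one bosonic mode;
`|n⟩` is `Finsupp.single n 1`. -/
abbrev Fock : Type := ℕ →₀ ℂ

/-- The creation operator `a†`, `a†|n⟩ = √(n+1) |n+1⟩`. -/
noncomputable def create : Module.End ℂ Fock :=
  Finsupp.linearCombination ℂ fun n : ℕ => Finsupp.single (n + 1) ((Real.sqrt (n + 1) : ℝ) : ℂ)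

/-- The annihilation operator `a`, `a|n⟩ = √n |n-1⟩`; for `n = 0` the coefficient vanishes. -/
noncomputable def annihilate : Module.End ℂ Fock :=
  Finsupp.linearCombination ℂ fun n : ℕ => Finsupp.single (n - 1) ((Real.sqrt n : ℝ) : ℂ)

/-- The number operator `n̂ = a† a`. -/
noncomputable def number : Module.End ℂ Fock := create * annihilate

/-- The blockade drive `a† (n̂ - r)`. -/
noncomputable def drive (r : ℕ) : Module.End ℂ Fock :=
  create * (number - (r : ℂ) • 1)

/-- The Hermitian conjugate `(n̂ - r) a` of the blockade drive. -/
noncomputable def driveAdj (r : ℕ) : Module.End ℂ Fock :=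
  (number - (r : ℂ) • 1) * annihilate

/-- Operators on the `(r+1)`-dimensional blockade subspace spanned by `|0⟩, …, |r⟩`, written in
the Fock basis. -/
abbrev Op (r : ℕ) : Type := Matrix (Fin (r + 1)) (Fin (r + 1)) ℂ

/-- The compression `Π_r X Π_r` of `X` to the blockade subspace: the matrix `⟨m|X|n⟩`,
`0 ≤ m, n ≤ r`. -/
noncomputable def compress (r : ℕ) (X : Module.End ℂ Fock) : Op r :=
  Matrix.of fun m n => X (Finsupp.single (n : ℕ) 1) (m : ℕ)

/-! ### The Hamiltonian in the blockade subspace -/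

/-- `H_{c,R} = Π_r (a† (n̂ - r) + h.c.) Π_r`. -/
noncomputable def controlR (r : ℕ) : Op r := compress r (drive r + driveAdj r)

/-- `H_{c,I} = Π_r (i a† (n̂ - r) + h.c.) Π_r`. -/
noncomputable def controlI (r : ℕ) : Op r :=
  compress r (Complex.I • drive r - Complex.I • driveAdj r)

/-- The drift `H_{d,0} = Π_r ((χ/2) a†² a² + Δ₀ a† a) Π_r`. -/
noncomputable def drift (r : ℕ) (χ Δ₀ : ℝ) : Op r :=
  compress r (((χ / 2 : ℝ) : ℂ) • (create ^ 2 * annihilate ^ 2) + (Δ₀ : ℂ) • number)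

/-- The control Hamiltonian `χ Re α H_{c,R} + χ Im α H_{c,I}` at the value `α` of the control,
i.e. the compression of `χ α a† (n̂ - r) + h.c.`. -/
noncomputable def control (r : ℕ) (χ : ℝ) (α : ℂ) : Op r :=
  ((χ * α.re : ℝ) : ℂ) • controlR r + ((χ * α.im : ℝ) : ℂ) • controlI r

/-! ### Lie algebra and levels -/

/-- The real Lie algebra `𝔰𝔲(N)` of traceless skew-Hermitian `N × N` matrices. -/
def su (N : ℕ) : LieSubalgebra ℝ (Matrix (Fin N) (Fin N) ℂ) where
  carrier := {A | Aᴴ = -A ∧ A.trace = 0}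
  add_mem' := by
    rintro A B ⟨hA, hA'⟩ ⟨hB, hB'⟩
    refine ⟨?_, by rw [Matrix.trace_add, hA', hB', add_zero]⟩
    rw [Matrix.conjTranspose_add, hA, hB, neg_add]
  zero_mem' := by simp
  smul_mem' := by
    rintro c A ⟨hA, hA'⟩
    refine ⟨?_, by rw [Matrix.trace_smul, hA', smul_zero]⟩
    rw [Matrix.conjTranspose_smul, hA, star_trivial, smul_neg]
  lie_mem' := by
    rintro A B ⟨hA, -⟩ ⟨hB, -⟩
    constructor
    · rw [Ring.lie_def, Matrix.conjTranspose_sub, Matrix.conjTranspose_mul,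
        Matrix.conjTranspose_mul, hA, hB]
      simp only [neg_mul_neg, neg_sub]
    · rw [Ring.lie_def, Matrix.trace_sub, Matrix.trace_mul_comm, sub_self]

/-- The gap `μ_k = E_k - E_{k+1}`, `0 ≤ k ≤ N - 2`, of levels `E_0, …, E_{N-1}`, where `N = r+1`. -/
def gap {r : ℕ} (E : Fin (r + 1) → ℝ) (k : Fin r) : ℝ := E k.castSucc - E k.succ

/-- The anharmonicity condition: the first gap `μ_0`, or else the last gap `μ_{N-2}`, is nonzero and
its square differs from the squares of all the other gaps. -/
def Anharmonic {r : ℕ} (E : Fin (r + 1) → ℝ) : Prop :=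
  ∃ j : Fin r, ((j : ℕ) = 0 ∨ (j : ℕ) + 1 = r) ∧ gap E j ≠ 0 ∧
    ∀ k : Fin r, k ≠ j → gap E k ^ 2 ≠ gap E j ^ 2

/-- The levels `-2 [3 n² - (4 r + 1) n + r²]`, `0 ≤ n ≤ r`. -/
def level (r : ℕ) (n : Fin (r + 1)) : ℝ :=
  -2 * (3 * (n : ℝ) ^ 2 - (4 * (r : ℝ) + 1) * (n : ℝ) + (r : ℝ) ^ 2)

/-! ### Time evolution -/

/-- `U` is the propagator `U(t) = 𝒯 exp(-i ∫₀ᵗ H)` of the time-dependent Hamiltonian `H` on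
`[0, T]`: the solution of `U'(t) = -i H(t) U(t)`, `U(0) = 1`. -/
def IsPropagator {r : ℕ} (H : ℝ → Op r) (T : ℝ) (U : ℝ → Op r) : Prop :=
  U 0 = 1 ∧ ∀ t ∈ Set.Icc 0 T,
    HasDerivWithinAt U ((-Complex.I) • (H t * U t)) (Set.Icc 0 T) t

/-- The control `α`, given on `[0, 1]`, run on `[0, T]` with the amplitude multiplied by `1 / T`. -/
noncomputable def speedUp (α : ℝ → ℂ) (T : ℝ) (t : ℝ) : ℂ := ((T⁻¹ : ℝ) : ℂ) * α (t / T)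

end KerrBlockade

/-!
Write `X = i H_{c,R}` and `D = [i H_{c,R}, i H_{c,I}]`. In the Fock basis `X` is a sum of hops
between neighbouring levels, all of them with nonzero amplitude, and `D` is diagonal. Since
`(ad D)²` acts on the hop of gap `μ_k` as `-μ_k²`, applying the operators `μ_k² + (ad D)²` to
`X` isolates the hop at the end of the chain whose gap is special. The bracket of that hop with its
partner is a diagonal matrix which separates the next hop from the remaining ones, so all hops are
obtained one after another, and they generate `𝔰𝔲(N)`.

A smooth pulse of a constant control steers to the exponential of its generator, and concatenation
makes the reachable endpoints a monoid `M`. For every monoid `M` in a finite-dimensional algebra the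
matrices `A` with `exp (ℝ A) ⊆ M` form a Lie algebra. To see this, let `V` be their span, which is
invariant under conjugation by the units of `M`. A product `f` of one-parameter groups in `M` has
logarithmic derivative in `V` and parametrizes a neighbourhood of `1` transversally to a complement
of `V`; for `A ∈ V`, the transversal component of `exp (t A)` has zero derivative, so that
`exp (t A)` is a value of `f` for small `t`. As every special unitary matrix is the exponential of
an element of `𝔰𝔲(N)`, it is reachable.

In the rescaled time `t / T` the drift carries the factor `T`, and Grönwall's inequality bounds its
effect.
-/

namespace KerrBlockade

/-! ### Generation of `𝔰𝔲(N)` by anharmonic levels -/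

section Skew

variable {n : Type*} [DecidableEq n]

/-- The skew-Hermitian matrix `z |i⟩⟨j| - z̄ |j⟩⟨i|`, as a real-linear function of `z`. -/
noncomputable def skew (i j : n) : ℂ →ₗ[ℝ] Matrix n n ℂ where
  toFun z := Matrix.single i j z - Matrix.single j i (star z)
  map_add' z w := by rw [star_add, Matrix.single_add, Matrix.single_add]; abel
  map_smul' c z := by simp [smul_sub, Matrix.smul_single]

lemma skew_apply (i j : n) (z : ℂ) :
    skew i j z = Matrix.single i j z - Matrix.single j i (star z) := rfl

/-- The skew-Hermitian matrix `i ∑ F_l |l⟩⟨l|` of the levels `F`. -/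
noncomputable def skewDiagonal (F : n → ℝ) : Matrix n n ℂ :=
  Matrix.diagonal fun l => Complex.I * (F l : ℂ)

lemma skew_swap (i j : n) (z : ℂ) : skew j i z = skew i j (-star z) := by
  rw [skew_apply, skew_apply, star_neg, star_star, ← Matrix.single_neg, ← Matrix.single_neg]
  abel

lemma skew_self_I_sub (i j : n) :
    skew j j Complex.I - skew i i Complex.I =
      skewDiagonal (Pi.single j (2 : ℝ) - Pi.single i 2) := by
  have skew_self (l : n) : skew l l Complex.I = Matrix.diagonal (Pi.single l (2 * Complex.I)) := by
    rw [skew_apply, Complex.star_def, Complex.conj_I, ← Matrix.single_neg, sub_neg_eq_add,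
      ← Matrix.single_add, Matrix.diagonal_single, two_mul]
  rw [skew_self, skew_self, Matrix.diagonal_sub, skewDiagonal]
  congr 1
  ext l
  simp only [Pi.sub_apply, Pi.single_apply]
  split_ifs <;> push_cast <;> ring

variable [Fintype n]

lemma lie_skew_skew {i j k : n} (hij : i ≠ j) (hjk : j ≠ k) (hik : i ≠ k) (z w : ℂ) :
    ⁅skew i j z, skew j k w⁆ = skew i k (z * w) := by
  simp [skew_apply, Ring.lie_def, mul_sub, sub_mul, Matrix.single_mul_single_of_ne, hij, hjk, hik,
    hij.symm, hjk.symm, hik.symm, mul_comm]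

lemma lie_skew_skew_one {i j : n} (hij : i ≠ j) (z : ℂ) :
    ⁅skew i j z, skew i j 1⁆ = skew j j z - skew i i z := by
  simp only [skew_apply, Ring.lie_def, star_one, mul_sub, sub_mul,
    Matrix.single_mul_single_same, Matrix.single_mul_single_of_ne, ne_eq, hij, hij.symm,
    not_false_eq_true, mul_one, one_mul]
  abel

lemma lie_skewDiagonal_skew (F : n → ℝ) (i j : n) (z : ℂ) :
    ⁅skewDiagonal F, skew i j z⁆ = skew i j (Complex.I * ((F i - F j : ℝ) : ℂ) * z) := by
  have diagonal_mul_single (d : n → ℂ) (a b : n) (w : ℂ) :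
      Matrix.diagonal d * Matrix.single a b w = Matrix.single a b (d a * w) := by
    ext; grind [Matrix.diagonal_mul]
  have single_mul_diagonal (d : n → ℂ) (a b : n) (w : ℂ) :
      Matrix.single a b w * Matrix.diagonal d = Matrix.single a b (w * d b) := by
    ext; grind [Matrix.mul_diagonal]
  simp only [Ring.lie_def, skewDiagonal, skew_apply, mul_sub, sub_mul, diagonal_mul_single,
    single_mul_diagonal, Complex.star_def, map_mul, Complex.conj_I, Complex.conj_ofReal]
  rw [sub_sub_sub_comm, sub_eq_add_neg (Matrix.single i j _), sub_eq_add_neg (Matrix.single j i _),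
    Matrix.single_neg, Matrix.single_neg, ← Matrix.single_add, ← Matrix.single_add]
  congr 2 <;> push_cast <;> ring

lemma sum_skew_eq_two_smul {A : Matrix n n ℂ} (hA : Aᴴ = -A) :
    ∑ i, ∑ j, skew i j (A i j) = (2 : ℝ) • A := by
  have h : ∑ i, ∑ j, Matrix.single j i (star (A i j)) = Aᴴ := by
    rw [Finset.sum_comm]
    exact (Matrix.matrix_eq_sum_single Aᴴ).symm
  simp only [skew_apply, Finset.sum_sub_distrib]
  rw [← Matrix.matrix_eq_sum_single, h, hA, sub_neg_eq_add, two_smul]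

/-- Bracketing with a diagonal matrix multiplies the entry `w` by an imaginary number, which
together with `w` spans `ℂ` over `ℝ`. -/
lemma skew_mem_of_skewDiagonal_mem {L : LieSubalgebra ℝ (Matrix n n ℂ)} {F : n → ℝ}
    (hF : skewDiagonal F ∈ L) {i j : n} (hij : F i ≠ F j) {w : ℂ} (hw : w ≠ 0)
    (hwL : skew i j w ∈ L) (z : ℂ) : skew i j z ∈ L := by
  have hIw : skew i j (Complex.I * ((F i - F j : ℝ) : ℂ) * w) ∈ L :=
    lie_skewDiagonal_skew F i j w ▸ L.lie_mem hF hwL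
  have hc : ((F i - F j : ℝ) : ℂ) ≠ 0 := by exact_mod_cast sub_ne_zero.2 hij
  have hz : z = (z / w).re • w +
      ((z / w).im / (F i - F j)) • (Complex.I * ((F i - F j : ℝ) : ℂ) * w) := by
    have h : z = ((z / w).re + (z / w).im * Complex.I) * w := by
      rw [Complex.re_add_im, div_mul_cancel₀ _ hw]
    rw [Complex.real_smul, Complex.real_smul, Complex.ofReal_div]
    conv_lhs => rw [h]
    field_simp
  rw [hz, map_add, map_smul, map_smul]
  exact L.add_mem (L.smul_mem _ hwL) (L.smul_mem _ hIw)

end Skew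

lemma skew_mem_su {N : ℕ} {i j : Fin N} (hij : i ≠ j) (z : ℂ) : skew i j z ∈ su N :=
  ⟨by simp [skew_apply, Matrix.conjTranspose_single],
    by simp [skew_apply, Matrix.trace_single_eq_of_ne, hij, hij.symm]⟩

lemma su_le_of_forall_skew_mem {N : ℕ} {L : LieSubalgebra ℝ (Matrix (Fin N) (Fin N) ℂ)}
    (hL : ∀ i j, i ≠ j → ∀ z, skew i j z ∈ L) : su N ≤ L := by
  rintro A ⟨hA, htr⟩
  obtain _ | r := N
  · exact Subsingleton.elim 0 A ▸ L.zero_mem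
  have hdiag (i : Fin (r + 1)) (z : ℂ) : skew i i z - skew 0 0 z ∈ L := by
    rcases eq_or_ne 0 i with rfl | hi
    · rw [sub_self]; exact L.zero_mem
    · rw [← lie_skew_skew_one hi]
      exact L.lie_mem (hL 0 i hi z) (hL 0 i hi 1)
  have htrace : ∑ i, skew (0 : Fin (r + 1)) 0 (A i i) = 0 := by
    rw [← map_sum, show ∑ i, A i i = 0 from htr, map_zero]
  have hdecomp : (2 : ℝ) • A = ∑ i, (∑ j ∈ Finset.univ.erase i, skew i j (A i j) +
      (skew i i (A i i) - skew 0 0 (A i i))) := by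
    rw [← sum_skew_eq_two_smul hA, Finset.sum_add_distrib, Finset.sum_sub_distrib, htrace,
      sub_zero, ← Finset.sum_add_distrib]
    exact Finset.sum_congr rfl fun i _ => (Finset.sum_erase_add _ _ (Finset.mem_univ i)).symm
  have h2A : (2 : ℝ) • A ∈ L := hdecomp ▸ sum_mem fun i _ => L.add_mem
    (sum_mem fun j hj => hL i j (Finset.ne_of_mem_erase hj).symm _) (hdiag i _)
  exact (L.toSubmodule.smul_mem_iff two_ne_zero).1 h2A

section Hop

variable {r : ℕ}

/-- The matrix `z |k⟩⟨k+1| - z̄ |k+1⟩⟨k|` coupling neighbouring levels. -/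
noncomputable abbrev hop (k : Fin r) : ℂ →ₗ[ℝ] Op r := skew k.castSucc k.succ

lemma lie_skewDiagonal_sum_hop (F : Fin (r + 1) → ℝ) (z : Fin r → ℂ) :
    ⁅skewDiagonal F, ∑ k, hop k (z k)⁆ = ∑ k, hop k (Complex.I * (gap F k : ℂ) * z k) := by
  rw [lie_sum]
  exact Finset.sum_congr rfl fun k _ => lie_skewDiagonal_skew F _ _ _

variable {L : LieSubalgebra ℝ (Op r)} {E : Fin (r + 1) → ℝ} {z : Fin r → ℂ} {j k : Fin r}

/-- The operator `μ_a² + (ad D)²` annihilates the hop of gap `μ_a` and multiplies each of the other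
hops by `μ_a² - μ_k²`. -/
lemma sum_hop_sq_gap_sub_mem (hD : skewDiagonal E ∈ L) (hX : ∑ k, hop k (z k) ∈ L) (a : Fin r) :
    ∑ k, hop k ((gap E a ^ 2 - gap E k ^ 2) • z k) ∈ L := by
  have hadD := L.lie_mem hD (L.lie_mem hD hX)
  rw [lie_skewDiagonal_sum_hop, lie_skewDiagonal_sum_hop] at hadD
  convert L.add_mem (L.smul_mem (gap E a ^ 2) hX) hadD using 1
  rw [Finset.smul_sum, ← Finset.sum_add_distrib]
  refine Finset.sum_congr rfl fun k _ => ?_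
  rw [← map_smul, ← map_add]
  congr 1
  simp only [Complex.real_smul]
  push_cast
  linear_combination -(gap E k : ℂ) ^ 2 * z k * Complex.I_sq

lemma exists_hop_mem (hD : skewDiagonal E ∈ L) (hX : ∑ k, hop k (z k) ∈ L) (hz : z j ≠ 0)
    (hj : ∀ k, k ≠ j → gap E k ^ 2 ≠ gap E j ^ 2) : ∃ w : ℂ, w ≠ 0 ∧ hop j w ∈ L := by
  have annihilate_hops (S : Finset (Fin r)) (hS : j ∉ S) :
      ∃ w : Fin r → ℂ, w j ≠ 0 ∧ (∀ k ∈ S, w k = 0) ∧ ∑ k, hop k (w k) ∈ L := by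
    induction S using Finset.induction_on with
    | empty => exact ⟨z, hz, by simp, hX⟩
    | insert a S _ ih =>
      obtain ⟨hja, hjS⟩ := not_or.1 (Finset.mem_insert.not.1 hS)
      obtain ⟨w, hwj, hwS, hw⟩ := ih hjS
      refine ⟨_, smul_ne_zero (sub_ne_zero.2 (hj a (Ne.symm hja))) hwj, fun k hk => ?_,
        sum_hop_sq_gap_sub_mem hD hw a⟩
      rcases Finset.mem_insert.1 hk with rfl | hk
      · rw [sub_self, zero_smul]
      · rw [hwS k hk, smul_zero]
  obtain ⟨w, hwj, hwS, hw⟩ := annihilate_hops (Finset.univ.erase j) (by simp)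
  refine ⟨w j, hwj, ?_⟩
  rwa [Finset.sum_eq_single j (fun k _ hk => by rw [hwS k (by simp [hk]), map_zero])
    (by simp)] at hw

/-- The levels `F` of `[hop j i, hop j 1]` distinguish the hops next to `j` from all the hops
further away, since the latter have gap zero. -/
lemma hop_mem_of_adjacent (hX : ∑ k, hop k (z k) ∈ L) (hz : z k ≠ 0)
    (hjk : (j : ℕ) + 1 = k ∨ (k : ℕ) + 1 = j) (hj : ∀ w, hop j w ∈ L)
    (hnbr : ∀ l : Fin r, l ≠ k → (j : ℕ) + 1 = l ∨ (l : ℕ) + 1 = j → ∀ w, hop l w ∈ L) (w : ℂ) :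
    hop k w ∈ L := by
  set F : Fin (r + 1) → ℝ := Pi.single j.succ 2 - Pi.single j.castSucc 2 with hF
  have hFL : skewDiagonal F ∈ L := by
    rw [← skew_self_I_sub, ← lie_skew_skew_one j.castSucc_lt_succ.ne]
    exact L.lie_mem (hj _) (hj _)
  have gap_adjacent : gap F k = 2 := by
    simp only [hF, gap, Pi.sub_apply, Pi.single_apply, Fin.ext_iff, Fin.val_castSucc, Fin.val_succ]
    split_ifs <;> first | omega | norm_num
  have gap_far (l : Fin r) (hlj : l ≠ j) (hl : ¬ ((j : ℕ) + 1 = l ∨ (l : ℕ) + 1 = j)) :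
      gap F l = 0 := by
    simp only [ne_eq, Fin.ext_iff] at hlj
    simp only [hF, gap, Pi.sub_apply, Pi.single_apply, Fin.ext_iff, Fin.val_castSucc, Fin.val_succ]
    split_ifs <;> first | omega | norm_num
  have hsum := L.lie_mem hFL hX
  rw [lie_skewDiagonal_sum_hop, ← Finset.add_sum_erase _ _ (Finset.mem_univ k)] at hsum
  have hrest : ∑ l ∈ Finset.univ.erase k, hop l (Complex.I * (gap F l : ℂ) * z l) ∈ L := by
    refine sum_mem fun l hl => ?_
    by_cases hlj : l = j
    · exact hlj ▸ hj _
    by_cases hadj : (j : ℕ) + 1 = l ∨ (l : ℕ) + 1 = j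
    · exact hnbr l (Finset.ne_of_mem_erase hl) hadj _
    · rw [gap_far l hlj hadj, Complex.ofReal_zero, mul_zero, zero_mul, map_zero]
      exact L.zero_mem
  have hk := (L.toSubmodule.add_mem_iff_left hrest).1 hsum
  refine skew_mem_of_skewDiagonal_mem hFL ?_ ?_ hk w
  · exact sub_ne_zero.1 (gap_adjacent.trans_ne two_ne_zero)
  · simp [gap_adjacent, hz]

lemma hop_mem_of_end (hX : ∑ k, hop k (z k) ∈ L) (hz : ∀ k, z k ≠ 0)
    (hend : (j : ℕ) = 0 ∨ (j : ℕ) + 1 = r) (hj : ∀ w, hop j w ∈ L) (k : Fin r) (w : ℂ) :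
    hop k w ∈ L := by
  induction hd : Nat.dist k j using Nat.strong_induction_on generalizing k w with
  | _ d ih =>
    subst hd
    have closer {l : Fin r} (hl : Nat.dist l j < Nat.dist k j) (v : ℂ) : hop l v ∈ L :=
      ih _ hl l v rfl
    simp only [Nat.dist] at closer
    rcases lt_trichotomy (k : ℕ) j with hlt | heq | hlt
    · exact hop_mem_of_adjacent (j := ⟨k + 1, by omega⟩) hX (hz k) (Or.inr rfl)
        (closer (by simp only; omega))
        (fun l hlk hl => closer (by simp only [ne_eq, Fin.ext_iff] at hlk hl; omega)) w
    · exact Fin.ext heq ▸ hj w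
    · exact hop_mem_of_adjacent (j := ⟨k - 1, by omega⟩) hX (hz k) (Or.inl (by simp only; omega))
        (closer (by simp only; omega))
        (fun l hlk hl => closer (by simp only [ne_eq, Fin.ext_iff] at hlk hl; omega)) w

lemma skew_mem_of_forall_hop_mem (hL : ∀ (k : Fin r) (w : ℂ), hop k w ∈ L) {i j : Fin (r + 1)}
    (hij : i ≠ j) (w : ℂ) : skew i j w ∈ L := by
  wlog h : i < j generalizing i j w
  · exact skew_swap j i w ▸ this hij.symm _ (lt_of_le_of_ne (not_lt.1 h) hij.symm)
  induction j using Fin.induction generalizing w with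
  | zero => exact absurd h (Fin.not_lt_zero i)
  | succ j ih =>
    rcases (Fin.le_castSucc_iff.2 h).eq_or_lt with rfl | hlt
    · exact hL j w
    · rw [← mul_one w, ← lie_skew_skew hlt.ne j.castSucc_lt_succ.ne hij]
      exact L.lie_mem (ih hlt.ne w hlt) (hL j 1)

theorem su_le_of_anharmonic (hE : Anharmonic E) (hD : skewDiagonal E ∈ L)
    (hX : ∑ k, hop k (z k) ∈ L) (hz : ∀ k, z k ≠ 0) : su (r + 1) ≤ L := by
  obtain ⟨j, hend, hgap, hj⟩ := hE
  obtain ⟨v, hv, hvL⟩ := exists_hop_mem hD hX (hz j) hj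
  have hhop := hop_mem_of_end hX hz hend
    (skew_mem_of_skewDiagonal_mem hD (sub_ne_zero.1 hgap) hv hvL)
  exact su_le_of_forall_skew_mem fun i j => skew_mem_of_forall_hop_mem hhop

end Hop

/-! ### The Lie algebra of a monoid of matrices -/

section TangentSet

variable {𝔸 : Type*} [NormedRing 𝔸] [NormedAlgebra ℝ 𝔸] {M : Submonoid 𝔸} {A : 𝔸}

/-- The generators of the one-parameter groups contained in a submonoid of a Banach algebra. -/
def tangentSet (M : Submonoid 𝔸) : Set 𝔸 := {A | ∀ s : ℝ, NormedSpace.exp (s • A) ∈ M}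

lemma exp_mem_of_mem_tangentSet (hA : A ∈ tangentSet M) : NormedSpace.exp A ∈ M :=
  one_smul ℝ A ▸ hA 1

lemma smul_mem_tangentSet (hA : A ∈ tangentSet M) (c : ℝ) : c • A ∈ tangentSet M :=
  fun s => smul_smul s c A ▸ hA (s * c)

variable [CompleteSpace 𝔸]

lemma exists_units_coe_eq_exp (hA : A ∈ tangentSet M) :
    ∃ u ∈ M.units, (u : 𝔸) = NormedSpace.exp A := by
  let := NormedAlgebra.restrictScalars ℚ ℝ 𝔸
  let := NormedSpace.invertibleExp A
  refine ⟨unitOfInvertible (NormedSpace.exp A), ⟨exp_mem_of_mem_tangentSet hA, ?_⟩, rfl⟩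
  have h := hA (-1)
  rwa [neg_one_smul] at h

lemma conj_mem_tangentSet {u : 𝔸ˣ} (hu : u ∈ M.units) (hA : A ∈ tangentSet M) :
    u * A * ↑u⁻¹ ∈ tangentSet M := fun s => by
  let := NormedAlgebra.restrictScalars ℚ ℝ 𝔸
  rw [← smul_mul_assoc, ← mul_smul_comm, NormedSpace.exp_units_conj]
  exact mul_mem (mul_mem hu.1 (hA s)) hu.2

lemma conj_mem_span_tangentSet {u : 𝔸ˣ} (hu : u ∈ M.units)
    (hA : A ∈ Submodule.span ℝ (tangentSet M)) :
    u * A * ↑u⁻¹ ∈ Submodule.span ℝ (tangentSet M) := by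
  let conj : 𝔸 →ₗ[ℝ] 𝔸 := LinearMap.mulRight ℝ ↑u⁻¹ ∘ₗ LinearMap.mulLeft ℝ ↑u
  have hconj : Submodule.span ℝ (tangentSet M) ≤ (Submodule.span ℝ (tangentSet M)).comap conj :=
    Submodule.span_le.2 fun B hB => Submodule.subset_span (conj_mem_tangentSet hu hB)
  exact hconj hA

lemma mem_tangentSet_of_eventually (h : ∀ᶠ t : ℝ in 𝓝 0, NormedSpace.exp (t • A) ∈ M) :
    A ∈ tangentSet M := fun s => by
  let := NormedAlgebra.restrictScalars ℚ ℝ 𝔸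
  have hlim : Filter.Tendsto (fun n : ℕ => s / n) Filter.atTop (𝓝 0) :=
    tendsto_const_div_atTop_nhds_zero_nat s
  obtain ⟨n, hn, hn0⟩ := ((hlim.eventually h).and (Filter.eventually_gt_atTop 0)).exists
  have hroot : s • A = n • ((s / n) • A) := by
    rw [← Nat.cast_smul_eq_nsmul ℝ, smul_smul, mul_div_cancel₀ _ (Nat.cast_ne_zero.2 hn0.ne')]
  rw [hroot, NormedSpace.exp_nsmul]
  exact pow_mem hn n

end TangentSet

section Chart

variable {𝔸 : Type*} [NormedRing 𝔸] [NormedAlgebra ℝ 𝔸] {M : Submonoid 𝔸}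
  {E : Type*} [NormedAddCommGroup E] [NormedSpace ℝ E] {f g : E → 𝔸}

/-- A continuously differentiable map into the units of `M` whose logarithmic derivative
`f⁻¹ df` takes values in the span of the generators of the one-parameter groups in `M`. -/
structure IsTangential (M : Submonoid 𝔸) (f : E → 𝔸) : Prop where
  contDiff : ContDiff ℝ 1 f
  exists_units (x : E) : ∃ u ∈ M.units, (u : 𝔸) = f x
  exists_fderiv_eq (x v : E) : ∃ X ∈ Submodule.span ℝ (tangentSet M), fderiv ℝ f x v = f x * X

lemma isTangential_one : IsTangential M (1 : E → 𝔸) where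
  contDiff := contDiff_const
  exists_units _ := ⟨1, one_mem _, rfl⟩
  exists_fderiv_eq x v := ⟨0, Submodule.zero_mem _, by
    rw [mul_zero, show (1 : E → 𝔸) = fun _ => 1 from rfl, fderiv_fun_const]; rfl⟩

variable [CompleteSpace 𝔸]

lemma IsTangential.mul (hf : IsTangential M f) (hg : IsTangential M g) :
    IsTangential M (f * g) where
  contDiff := hf.contDiff.mul hg.contDiff
  exists_units x := by
    obtain ⟨u, hu, hux⟩ := hf.exists_units x
    obtain ⟨w, hw, hwx⟩ := hg.exists_units x
    exact ⟨u * w, mul_mem hu hw, by rw [Units.val_mul, hux, hwx]; rfl⟩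
  exists_fderiv_eq x v := by
    obtain ⟨X, hX, hfX⟩ := hf.exists_fderiv_eq x v
    obtain ⟨Y, hY, hgY⟩ := hg.exists_fderiv_eq x v
    obtain ⟨u, hu, hux⟩ := hg.exists_units x
    refine ⟨Y + ↑u⁻¹ * X * u, Submodule.add_mem _ hY ?_, ?_⟩
    · simpa using conj_mem_span_tangentSet (inv_mem hu) hX
    · rw [fderiv_mul' (hf.contDiff.differentiable one_ne_zero x)
        (hg.contDiff.differentiable one_ne_zero x)]
      simp only [add_apply, smul_apply, smul_eq_mul,
        MulOpposite.smul_eq_mul_unop, MulOpposite.unop_op, Pi.mul_apply, hfX, hgY, ← hux]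
      simp only [mul_add, mul_assoc, Units.mul_inv_cancel_left]

lemma hasStrictFDerivAt_exp_smul (ℓ : E →L[ℝ] ℝ) (B : 𝔸) (x : E) :
    HasStrictFDerivAt (fun y => NormedSpace.exp (ℓ y • B))
      (ℓ.smulRight (NormedSpace.exp (ℓ x • B) * B)) x := by
  have hexp := (hasStrictDerivAt_exp_smul_const (𝕂 := ℝ) B (ℓ x)).hasStrictFDerivAt
  refine (hexp.comp x ℓ.hasStrictFDerivAt).congr_fderiv (ContinuousLinearMap.ext fun v => ?_)
  simp

lemma isTangential_exp_smul (ℓ : E →L[ℝ] ℝ) {B : 𝔸} (hB : B ∈ tangentSet M) :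
    IsTangential M fun x => NormedSpace.exp (ℓ x • B) where
  contDiff := by
    have hexp : ContDiff ℝ 1 (NormedSpace.exp : 𝔸 → 𝔸) :=
      contDiff_iff_contDiffAt.2 fun A => (NormedSpace.exp_analytic (𝕂 := ℝ) A).contDiffAt
    fun_prop
  exists_units x := exists_units_coe_eq_exp (smul_mem_tangentSet hB (ℓ x))
  exists_fderiv_eq x v := by
    refine ⟨ℓ v • B, Submodule.smul_mem _ _ (Submodule.subset_span hB), ?_⟩
    rw [(hasStrictFDerivAt_exp_smul ℓ B x).hasFDerivAt.fderiv, ContinuousLinearMap.smulRight_apply,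
      mul_smul_comm]

lemma exists_isTangential_hasFDerivAt_sum {ι : Type*} (s : Finset ι) (ℓ : ι → E →L[ℝ] ℝ)
    {B : ι → 𝔸} (hB : ∀ i, B i ∈ tangentSet M) :
    ∃ f : E → 𝔸, IsTangential M f ∧ f 0 = 1 ∧
      HasFDerivAt f (∑ i ∈ s, (ℓ i).smulRight (B i)) 0 := by
  classical
  induction s using Finset.induction_on with
  | empty => exact ⟨1, isTangential_one, rfl, hasFDerivAt_const 1 0⟩
  | insert i s hi ih =>
    obtain ⟨f, hf, hf0, hf'⟩ := ih
    have hexp := (hasStrictFDerivAt_exp_smul (ℓ i) (B i) 0).hasFDerivAt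
    refine ⟨_, (isTangential_exp_smul (ℓ i) (hB i)).mul hf, by simp [hf0], ?_⟩
    refine (hexp.mul' hf').congr_fderiv ?_
    rw [Finset.sum_insert hi, add_comm]
    ext v
    simp [hf0]

end Chart

section LocalFactorization

variable {𝔸 : Type*} [NormedRing 𝔸] [NormedAlgebra ℝ 𝔸] [FiniteDimensional ℝ 𝔸]

lemma exists_isTangential_hasFDerivAt_subtype (M : Submonoid 𝔸) :
    ∃ f : Submodule.span ℝ (tangentSet M) → 𝔸, IsTangential M f ∧ f 0 = 1 ∧
      HasFDerivAt f (Submodule.span ℝ (tangentSet M)).subtypeL 0 := by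
  have := FiniteDimensional.complete ℝ 𝔸
  let b := Module.Basis.ofSpan (Submodule.span_span_coe_preimage (R := ℝ) (s := tangentSet M)).ge
  let ℓ i := (b.coord i).toContinuousLinearMap
  have := FiniteDimensional.fintypeBasisIndex b
  obtain ⟨f, hf, hf0, hf'⟩ := exists_isTangential_hasFDerivAt_sum Finset.univ ℓ
    (B := fun i => (b i : 𝔸)) fun i =>
      show b i ∈ _ from Module.Basis.ofSpan_subset _ (Set.mem_range_self i)
  refine ⟨f, hf, hf0, hf'.congr_fderiv (ContinuousLinearMap.ext fun v => ?_)⟩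
  have hv := congrArg (Submodule.subtype _) (b.sum_repr v)
  rw [map_sum] at hv
  simpa [ℓ] using hv

variable {V Q : Submodule ℝ 𝔸}

lemma exists_local_factorization (hVQ : IsCompl V Q) {f : V → 𝔸} (hf : ContDiff ℝ 1 f)
    (hf0 : f 0 = 1) (hf' : HasFDerivAt f V.subtypeL 0) :
    ∃ (v : 𝔸 → V) (q : 𝔸 → Q), ContDiffAt ℝ 1 v 1 ∧ ContDiffAt ℝ 1 q 1 ∧ q 1 = 0 ∧
      ∀ᶠ y in 𝓝 1, f (v y) * (1 + q y) = y := by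
  have := FiniteDimensional.complete ℝ 𝔸
  let Ψ : V × Q → 𝔸 := fun x => f x.1 * (1 + x.2)
  have hΨ0 : Ψ 0 = 1 := by simp [Ψ, hf0]
  have hΨ : ContDiffAt ℝ 1 Ψ 0 :=
    ((hf.comp contDiff_fst).mul
      (contDiff_const.add (Q.subtypeL.contDiff.comp contDiff_snd))).contDiffAt
  have hΨ' : HasFDerivAt Ψ
      ((V.prodEquivOfIsCompl Q hVQ).toContinuousLinearEquiv : V × Q →L[ℝ] 𝔸) 0 := by
    have h1 : HasFDerivAt (fun x : V × Q => f x.1) _ 0 :=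
      HasFDerivAt.comp (g := f) 0 hf' hasFDerivAt_fst
    have h2 : HasFDerivAt (fun x : V × Q => 1 + (x.2 : 𝔸)) _ 0 :=
      (Q.subtypeL.hasFDerivAt.comp 0 hasFDerivAt_snd).const_add 1
    refine (h1.mul' h2).congr_fderiv (ContinuousLinearMap.ext fun x => ?_)
    simp [hf0, add_comm]
  have hinv := hΨ0 ▸ hΨ.to_localInverse hΨ' one_ne_zero
  have hinv1 := hΨ0 ▸ hΨ.localInverse_apply_image hΨ' one_ne_zero
  have hright := hΨ0 ▸ (hΨ.hasStrictFDerivAt' hΨ' one_ne_zero).eventually_right_inverse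
  exact ⟨fun y => (hΨ.localInverse hΨ' one_ne_zero y).1,
    fun y => (hΨ.localInverse hΨ' one_ne_zero y).2, hinv.fst, hinv.snd,
    congrArg Prod.snd hinv1, hright⟩

lemma eventually_eq_zero_of_mul_one_add_mem (hVQ : IsCompl V Q) :
    ∀ᶠ q in 𝓝 (0 : 𝔸), ∀ Y ∈ V, Y * (1 + q) ∈ Q → Y = 0 := by
  let π : 𝔸 →L[ℝ] V := (V.projectionOnto Q hVQ).toContinuousLinearMap
  have hlim : Filter.Tendsto (fun q : 𝔸 => ‖π‖ * ‖q‖) (𝓝 0) (𝓝 0) := by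
    simpa using (tendsto_norm_zero (E := 𝔸)).const_mul ‖π‖
  filter_upwards [hlim.eventually (gt_mem_nhds one_pos)] with q hq Y hY hYq
  have hπ : π (Y * q) = -⟨Y, hY⟩ := by
    have hsplit : π (Y * (1 + q)) = ⟨Y, hY⟩ + π (Y * q) := by
      rw [mul_add, mul_one, map_add]
      exact congrArg (· + _) (V.projectionOnto_apply_left hVQ ⟨Y, hY⟩)
    rw [eq_neg_iff_add_eq_zero, add_comm, ← hsplit]
    exact (V.projectionOnto_apply_eq_zero_iff hVQ).2 hYq
  by_contra hY0
  have hnorm : ‖Y‖ ≤ ‖π‖ * ‖q‖ * ‖Y‖ := calc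
    ‖Y‖ = ‖π (Y * q)‖ := by rw [hπ, norm_neg, Submodule.coe_norm]
    _ ≤ ‖π‖ * (‖Y‖ * ‖q‖) := π.le_opNorm_of_le (norm_mul_le Y q)
    _ = ‖π‖ * ‖q‖ * ‖Y‖ := by ring
  nlinarith [norm_pos_iff.2 hY0]

lemma hasDerivAt_exp_smul (A : 𝔸) (t : ℝ) :
    HasDerivAt (fun s : ℝ => NormedSpace.exp (s • A)) (A * NormedSpace.exp (t • A)) t :=
  have := FiniteDimensional.complete ℝ 𝔸
  hasDerivAt_exp_smul_const' (𝕂 := ℝ) A t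

/-- In the factorization `exp (t A) = f (v t) (1 + q t)`, both `A` and the logarithmic derivative
of `f` are tangent to `M`, hence so is `q' (1 + q)⁻¹`; but `q'` is transversal. -/
lemma IsTangential.deriv_eq_zero {M : Submonoid 𝔸} {W Q : Submodule ℝ 𝔸}
    {f : W → 𝔸} (hf : IsTangential M f) {A : 𝔸} (hA : A ∈ Submodule.span ℝ (tangentSet M))
    {v : ℝ → W} {q : ℝ → Q} {t : ℝ} (hv : DifferentiableAt ℝ v t) (hq : DifferentiableAt ℝ q t)
    (heq : ∀ᶠ s in 𝓝 t, f (v s) * (1 + q s) = NormedSpace.exp (s • A))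
    (hQ : ∀ Y ∈ Submodule.span ℝ (tangentSet M), Y * (1 + (q t : 𝔸)) ∈ Q → Y = 0) :
    deriv q t = 0 := by
  have := FiniteDimensional.complete ℝ 𝔸
  obtain ⟨X, hX, hfX⟩ := hf.exists_fderiv_eq (v t) (deriv v t)
  obtain ⟨u, hu, hut⟩ := hf.exists_units (v t)
  have hfv : HasDerivAt (fun s => f (v s)) (f (v t) * X) t :=
    hfX ▸ (hf.contDiff.differentiable one_ne_zero (v t)).hasFDerivAt.comp_hasDerivAt t hv.hasDerivAt
  have hq' : HasDerivAt (fun s => 1 + (q s : 𝔸)) ((deriv q t : Q) : 𝔸) t :=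
    (Q.subtypeL.hasFDerivAt.comp_hasDerivAt t hq.hasDerivAt).const_add 1
  have hprod := (hfv.mul hq').unique ((hasDerivAt_exp_smul A t).congr_of_eventuallyEq heq)
  have hderiv : ((↑u⁻¹ : 𝔸) * A * u - X) * (1 + (q t : 𝔸)) = (deriv q t : Q) := by
    rw [← heq.self_of_nhds, ← hut] at hprod
    rw [← Units.mul_right_inj u, eq_sub_of_add_eq' hprod]
    simp only [sub_mul, mul_sub, mul_assoc, Units.mul_inv_cancel_left]
  have hmem : (↑u⁻¹ : 𝔸) * A * u ∈ Submodule.span ℝ (tangentSet M) := by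
    simpa using conj_mem_span_tangentSet (inv_mem hu) hA
  have hzero := hQ _ (Submodule.sub_mem _ hmem hX) (hderiv ▸ (deriv q t).2)
  rw [hzero, zero_mul] at hderiv
  exact Subtype.ext hderiv.symm

theorem span_tangentSet_subset (M : Submonoid 𝔸) :
    (Submodule.span ℝ (tangentSet M) : Set 𝔸) ⊆ tangentSet M := fun A hA => by
  have := FiniteDimensional.complete ℝ 𝔸
  obtain ⟨f, hf, hf0, hf'⟩ := exists_isTangential_hasFDerivAt_subtype M
  obtain ⟨Q, hQ⟩ := (Submodule.span ℝ (tangentSet M)).exists_isCompl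
  obtain ⟨v, q, hv, hq, hq1, hfac⟩ := exists_local_factorization hQ hf.contDiff hf0 hf'
  have hexp : Filter.Tendsto (fun t : ℝ => NormedSpace.exp (t • A)) (𝓝 0) (𝓝 1) := by
    simpa using (hasDerivAt_exp_smul A 0).continuousAt.tendsto
  have hq0 : Filter.Tendsto (fun y => (q y : 𝔸)) (𝓝 1) (𝓝 0) := by
    have hcont := continuous_subtype_val.continuousAt.comp hq.continuousAt
    simpa [Function.comp_def, hq1] using hcont.tendsto
  have hnear := hexp.eventually <| (hv.eventually (by simp)).and <| (hq.eventually (by simp)).and <|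
    hfac.eventually_nhds.and <| hq0.eventually (eventually_eq_zero_of_mul_one_add_mem hQ)
  obtain ⟨ε, hε, hball⟩ := Metric.eventually_nhds_iff_ball.1 hnear
  have hdiff (t : ℝ) := (hasDerivAt_exp_smul A t).differentiableAt
  have hqdiff : DifferentiableOn ℝ (fun t : ℝ => q (NormedSpace.exp (t • A))) (Metric.ball 0 ε) :=
    fun t ht => (((hball t ht).2.1.differentiableAt one_ne_zero).comp t
      (hdiff t)).differentiableWithinAt
  have hderiv : (Metric.ball 0 ε).EqOn
      (deriv fun t : ℝ => q (NormedSpace.exp (t • A))) 0 := fun t ht => by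
    obtain ⟨hvt, hqt, hfact, hQt⟩ := hball t ht
    exact hf.deriv_eq_zero hA ((hvt.differentiableAt one_ne_zero).comp t (hdiff t))
      ((hqt.differentiableAt one_ne_zero).comp t (hdiff t))
      ((hasDerivAt_exp_smul A t).continuousAt.eventually hfact) hQt
  refine mem_tangentSet_of_eventually (Filter.mem_of_superset (Metric.ball_mem_nhds 0 hε) ?_)
  intro t ht
  change NormedSpace.exp (t • A) ∈ M
  have hqt : q (NormedSpace.exp (t • A)) = 0 := by
    have := Metric.isOpen_ball.is_const_of_deriv_eq_zero
      (convex_ball 0 ε).isPreconnected hqdiff hderiv ht (Metric.mem_ball_self hε)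
    simpa [hq1] using this
  have hfact := (hball t ht).2.2.1.self_of_nhds
  obtain ⟨u, hu, hut⟩ := hf.exists_units (v (NormedSpace.exp (t • A)))
  rw [hqt, Submodule.coe_zero, add_zero, mul_one] at hfact
  rw [← hfact, ← hut]
  exact hu.1

end LocalFactorization

section TangentAlgebra

variable {𝔸 : Type*} [NormedRing 𝔸] [NormedAlgebra ℝ 𝔸] [FiniteDimensional ℝ 𝔸]

lemma deriv_mem_of_forall_mem {E : Type*} [NormedAddCommGroup E] [NormedSpace ℝ E]
    {W : Submodule ℝ E} (hW : IsClosed (W : Set E)) {f : ℝ → E} {f' : E} {x : ℝ}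
    (hf : HasDerivAt f f' x) (h : ∀ t, f t ∈ W) : f' ∈ W := by
  refine hW.mem_of_tendsto hf.tendsto_slope (Filter.Eventually.of_forall fun t => ?_)
  rw [slope_def_module]
  exact W.smul_mem _ (W.sub_mem (h t) (h x))

lemma hasDerivAt_exp_conj (A B : 𝔸) :
    HasDerivAt (fun s : ℝ => NormedSpace.exp (s • A) * B * NormedSpace.exp (s • -A)) ⁅A, B⁆ 0 := by
  have hA := hasDerivAt_exp_smul A 0
  have hneg := hasDerivAt_exp_smul (-A) 0
  refine ((hA.mul_const B).mul hneg).congr_deriv ?_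
  simp [Ring.lie_def, sub_eq_add_neg]

/-- The Lie algebra of a submonoid of a finite-dimensional algebra: the generators of its
one-parameter groups. -/
def tangentAlgebra (M : Submonoid 𝔸) : LieSubalgebra ℝ 𝔸 where
  carrier := tangentSet M
  add_mem' hA hB := span_tangentSet_subset M
    (add_mem (Submodule.subset_span hA) (Submodule.subset_span hB))
  zero_mem' := span_tangentSet_subset M (zero_mem _)
  smul_mem' c _ hA := smul_mem_tangentSet hA c
  lie_mem' {A B} hA hB := by
    have := FiniteDimensional.complete ℝ 𝔸
    refine span_tangentSet_subset M (deriv_mem_of_forall_mem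
      (Submodule.closed_of_finiteDimensional _) (hasDerivAt_exp_conj A B) fun s => ?_)
    obtain ⟨u, hu, hus⟩ := exists_units_coe_eq_exp (smul_mem_tangentSet hA s)
    have hinv : (↑u⁻¹ : 𝔸) = NormedSpace.exp (s • -A) := by
      let := NormedAlgebra.restrictScalars ℚ ℝ 𝔸
      rw [smul_neg, Units.inv_eq_of_mul_eq_one_right]
      rw [hus, ← NormedSpace.exp_add_of_commute (Commute.refl (s • A)).neg_right, add_neg_cancel,
        NormedSpace.exp_zero]
    exact hus ▸ hinv ▸ conj_mem_span_tangentSet hu (Submodule.subset_span hB)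

theorem exp_mem_of_mem_lieSpan {S : Set 𝔸} {M : Submonoid 𝔸} (hS : S ⊆ tangentSet M) {A : 𝔸}
    (hA : A ∈ LieSubalgebra.lieSpan ℝ 𝔸 S) : NormedSpace.exp A ∈ M :=
  have hle : LieSubalgebra.lieSpan ℝ 𝔸 S ≤ tangentAlgebra M := LieSubalgebra.lieSpan_le.2 hS
  exp_mem_of_mem_tangentSet (hle hA)

end TangentAlgebra

/-! ### Surjectivity of the exponential map -/

section SpecialUnitary

lemma exists_sum_eq_zero_exp_I_eq {n : Type*} [Fintype n] {θ : n → ℝ}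
    (hθ : ∏ i, Complex.exp (Complex.I * θ i) = 1) :
    ∃ φ : n → ℝ, ∑ i, φ i = 0 ∧
      ∀ i, Complex.exp (Complex.I * φ i) = Complex.exp (Complex.I * θ i) := by
  classical
  obtain hn | ⟨⟨j⟩⟩ := isEmpty_or_nonempty n
  · exact ⟨θ, Fintype.sum_empty θ, fun _ => rfl⟩
  rw [← Complex.exp_sum, ← Finset.mul_sum, Complex.exp_eq_one_iff] at hθ
  obtain ⟨k, hk⟩ := hθ
  have hsum : ∑ i, θ i = k * (2 * Real.pi) := by
    have := mul_left_cancel₀ Complex.I_ne_zero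
      (hk.trans (by ring : _ = Complex.I * (k * (2 * Real.pi))))
    exact_mod_cast this
  refine ⟨θ - Pi.single j (k * (2 * Real.pi)), by simp [hsum], fun i => ?_⟩
  rw [Complex.exp_eq_exp_iff_exists_int]
  obtain rfl | hij := eq_or_ne i j
  · exact ⟨-k, by simp; ring⟩
  · exact ⟨0, by simp [hij]⟩

open scoped Matrix.Norms.L2Operator in
lemma exists_isHermitian_exp_eq {n : Type*} [Fintype n] [DecidableEq n] {V : Matrix n n ℂ}
    (hV : V ∈ Matrix.unitaryGroup n ℂ) :
    ∃ H : Matrix n n ℂ, H.IsHermitian ∧ NormedSpace.exp (Complex.I • H) = V := by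
  have hnormal : IsStarNormal V :=
    ⟨(Unitary.mem_iff.1 hV).1.trans (Unitary.mem_iff.1 hV).2.symm⟩
  have hcont (f : ℂ → ℂ) : ContinuousOn f (spectrum ℂ V) :=
    (Matrix.finite_spectrum V).continuousOn f
  refine ⟨cfc (fun z : ℂ => (Complex.arg z : ℂ)) V, IsSelfAdjoint.cfc_arg V, ?_⟩
  rw [← cfc_smul Complex.I _ V (hcont _), ← CFC.complex_exp_eq_normedSpace_exp,
    ← cfc_comp' Complex.exp _ V Complex.continuous_exp.continuousOn (hcont _)]
  conv_rhs => rw [← cfc_id' ℂ V]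
  refine cfc_congr fun z hz => ?_
  simpa [spectrum.norm_eq_one_of_unitary hV hz, mul_comm] using Complex.norm_mul_exp_arg_mul_I z

lemma exp_conj_diagonal {n : Type*} [Fintype n] [DecidableEq n] (U : Matrix.unitaryGroup n ℂ)
    (c : n → ℂ) :
    NormedSpace.exp ((U : Matrix n n ℂ) * Matrix.diagonal c * star (U : Matrix n n ℂ)) =
      U * Matrix.diagonal (fun i => Complex.exp (c i)) * star (U : Matrix n n ℂ) := by
  rw [← Matrix.inv_eq_right_inv (Unitary.mul_star_self_of_mem U.2),
    Matrix.exp_conj _ _ (Unitary.isUnit_coe), Matrix.exp_diagonal]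
  simp only [Pi.exp_def, Complex.exp_eq_exp_ℂ]

lemma exists_eq_conj_diagonal_exp {n : Type*} [Fintype n] [DecidableEq n] {V : Matrix n n ℂ}
    (hV : V ∈ Matrix.unitaryGroup n ℂ) :
    ∃ (U : Matrix.unitaryGroup n ℂ) (θ : n → ℝ), V =
      U * Matrix.diagonal (fun i => Complex.exp (Complex.I * θ i)) * star (U : Matrix n n ℂ) := by
  obtain ⟨H, hH, rfl⟩ := exists_isHermitian_exp_eq hV
  refine ⟨hH.eigenvectorUnitary, hH.eigenvalues, ?_⟩
  rw [← exp_conj_diagonal]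
  conv_lhs => rw [hH.spectral_theorem, Unitary.conjStarAlgAut_apply]
  rw [← smul_mul_assoc, ← mul_smul_comm, ← Matrix.diagonal_smul]
  rfl

theorem exists_mem_su_exp_eq {N : ℕ} {V : Matrix (Fin N) (Fin N) ℂ}
    (hV : V ∈ Matrix.specialUnitaryGroup (Fin N) ℂ) : ∃ A ∈ su N, NormedSpace.exp A = V := by
  obtain ⟨hunitary, hdet⟩ := Matrix.mem_specialUnitaryGroup_iff.1 hV
  obtain ⟨U, θ, rfl⟩ := exists_eq_conj_diagonal_exp hunitary
  have hU : star (U : Matrix (Fin N) (Fin N) ℂ) * U = 1 := Unitary.star_mul_self_of_mem U.2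
  rw [Matrix.det_mul_comm, ← mul_assoc, hU, one_mul, Matrix.det_diagonal] at hdet
  obtain ⟨φ, hφ, hexp⟩ := exists_sum_eq_zero_exp_I_eq hdet
  refine ⟨U * skewDiagonal φ * star U.1, ⟨?_, ?_⟩, ?_⟩
  · have hdiag : (skewDiagonal φ)ᴴ = -skewDiagonal φ := by
      rw [skewDiagonal, Matrix.diagonal_conjTranspose, Matrix.diagonal_neg]
      congr 1
      funext i
      simp
    simp only [Matrix.star_eq_conjTranspose, Matrix.conjTranspose_mul,
      Matrix.conjTranspose_conjTranspose, hdiag, mul_assoc, neg_mul, mul_neg]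
  · rw [Matrix.trace_mul_comm, ← mul_assoc, hU, one_mul, skewDiagonal, Matrix.trace_diagonal,
      ← Finset.mul_sum, ← Complex.ofReal_sum, hφ, Complex.ofReal_zero, mul_zero]
  · rw [skewDiagonal, exp_conj_diagonal]
    simp only [hexp]

end SpecialUnitary

/-! ### Smooth steering -/

section Steering

variable {𝔸 : Type*} [NormedRing 𝔸] [NormedAlgebra ℝ 𝔸] {E : Type*} [NormedAddCommGroup E]
  [NormedSpace ℝ E] {h : E →L[ℝ] 𝔸} {α β : ℝ → E} {U W : ℝ → 𝔸} {V X : 𝔸}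

/-- The smooth control `α` drives the solution `U` of `U' = h(α) U` from `1` to `V` during `[0, 1]`.
The control vanishes outside of `[0, 1]`, so that controls can be concatenated smoothly. -/
structure Steers (h : E →L[ℝ] 𝔸) (α : ℝ → E) (U : ℝ → 𝔸) (V : 𝔸) : Prop where
  contDiff : ContDiff ℝ ∞ α
  control_of_nonpos : ∀ t ≤ 0, α t = 0
  control_of_one_le : ∀ t, 1 ≤ t → α t = 0
  of_nonpos : ∀ t ≤ 0, U t = 1
  of_one_le : ∀ t, 1 ≤ t → U t = V
  hasDerivAt : ∀ t, HasDerivAt U (h (α t) * U t) t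

lemma Steers.refl (h : E →L[ℝ] 𝔸) : Steers h 0 1 1 where
  contDiff := contDiff_const
  control_of_nonpos _ _ := rfl
  control_of_one_le _ _ := rfl
  of_nonpos _ _ := rfl
  of_one_le _ _ := rfl
  hasDerivAt t := by
    rw [Pi.zero_apply, map_zero, zero_mul]
    exact hasDerivAt_const t 1

lemma Steers.trans (hU : Steers h α U V) (hW : Steers h β W X) :
    Steers h (fun t => (2 : ℝ) • (α (2 * t) + β (2 * t - 1)))
      (fun t => W (2 * t - 1) * U (2 * t)) (X * V) where
  contDiff := by
    have hα := hU.contDiff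
    have hβ := hW.contDiff
    fun_prop
  control_of_nonpos t ht := by
    rw [hU.control_of_nonpos _ (by linarith), hW.control_of_nonpos _ (by linarith), add_zero,
      smul_zero]
  control_of_one_le t ht := by
    rw [hU.control_of_one_le _ (by linarith), hW.control_of_one_le _ (by linarith), add_zero,
      smul_zero]
  of_nonpos t ht := by
    rw [hU.of_nonpos _ (by linarith), hW.of_nonpos _ (by linarith), one_mul]
  of_one_le t ht := by
    rw [hU.of_one_le _ (by linarith), hW.of_one_le _ (by linarith)]
  hasDerivAt t := by
    have htwo : HasDerivAt (fun t : ℝ => 2 * t) 2 t := hasDerivAt_const_mul 2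
    refine (((hW.hasDerivAt _).scomp t (htwo.sub_const 1)).mul
      ((hU.hasDerivAt _).scomp t htwo)).congr_deriv ?_
    have hcommute : W (2 * t - 1) * h (α (2 * t)) = h (α (2 * t)) * W (2 * t - 1) := by
      obtain ht | ht := le_total (2 * t) 1
      · rw [hW.of_nonpos (2 * t - 1) (by linarith), one_mul, mul_one]
      · rw [hU.control_of_one_le (2 * t) ht, map_zero, mul_zero, zero_mul]
    simp only [Function.comp_apply, map_smul, map_add, smul_mul_assoc, mul_smul_comm, ← smul_add]
    rw [← mul_assoc (W _), ← mul_assoc (_ + _), hcommute, ← add_mul, ← add_mul, add_comm]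

/-- The endpoints to which smooth controls steer the identity. -/
def reachable (h : E →L[ℝ] 𝔸) : Submonoid 𝔸 where
  carrier := {V | ∃ α U, Steers h α U V}
  one_mem' := ⟨0, 1, Steers.refl h⟩
  mul_mem' := by
    rintro X V ⟨β, W, hW⟩ ⟨α, U, hU⟩
    exact ⟨_, _, hU.trans hW⟩

lemma deriv_smoothTransition_of_nonpos {t : ℝ} (ht : t ≤ 0) : deriv Real.smoothTransition t = 0 :=
  have hmin : IsLocalMin Real.smoothTransition t := Filter.Eventually.of_forall fun s =>
    Real.smoothTransition.zero_of_nonpos ht ▸ Real.smoothTransition.nonneg s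
  hmin.deriv_eq_zero

lemma deriv_smoothTransition_of_one_le {t : ℝ} (ht : 1 ≤ t) : deriv Real.smoothTransition t = 0 :=
  have hmax : IsLocalMax Real.smoothTransition t := Filter.Eventually.of_forall fun s =>
    Real.smoothTransition.one_of_one_le ht ▸ Real.smoothTransition.le_one s
  hmax.deriv_eq_zero

lemma steers_exp [CompleteSpace 𝔸] (h : E →L[ℝ] 𝔸) (v : E) :
    Steers h (fun t => deriv Real.smoothTransition t • v)
      (fun t => NormedSpace.exp (Real.smoothTransition t • h v)) (NormedSpace.exp (h v)) where
  contDiff := (Real.smoothTransition.contDiff.deriv' (n := ∞)).smul contDiff_const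
  control_of_nonpos t ht := by rw [deriv_smoothTransition_of_nonpos ht, zero_smul]
  control_of_one_le t ht := by rw [deriv_smoothTransition_of_one_le ht, zero_smul]
  of_nonpos t ht := by
    rw [Real.smoothTransition.zero_of_nonpos ht, zero_smul, NormedSpace.exp_zero]
  of_one_le t ht := by rw [Real.smoothTransition.one_of_one_le ht, one_smul]
  hasDerivAt t := by
    have hpulse : HasDerivAt Real.smoothTransition (deriv Real.smoothTransition t) t :=
      (Real.smoothTransition.contDiff.differentiable one_ne_zero t).hasDerivAt
    refine ((hasDerivAt_exp_smul_const' (𝕂 := ℝ) (h v) _).scomp t hpulse).congr_deriv ?_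
    rw [map_smul, smul_mul_assoc]

theorem exp_mem_reachable_of_mem_lieSpan [FiniteDimensional ℝ 𝔸] {A : 𝔸}
    (hA : A ∈ LieSubalgebra.lieSpan ℝ 𝔸 (Set.range h)) : NormedSpace.exp A ∈ reachable h := by
  have := FiniteDimensional.complete ℝ 𝔸
  refine exp_mem_of_mem_lieSpan (Set.range_subset_iff.2 fun v s => ?_) hA
  exact map_smul h s v ▸ ⟨_, _, steers_exp h (s • v)⟩

end Steering

/-! ### Differential equations with a Lipschitz vector field -/

section LipschitzODE

open Set

variable {E : Type*} [NormedAddCommGroup E] [NormedSpace ℝ E] {v : ℝ → E → E} {K : NNReal}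

lemma hasDerivWithinAt_ite {f g : ℝ → E} {a b c : ℝ} (hab : a ≤ b) (hbc : b ≤ c) (hfg : f b = g b)
    (hf : ∀ t ∈ Icc a b, HasDerivWithinAt f (v t (f t)) (Icc a b) t)
    (hg : ∀ t ∈ Icc b c, HasDerivWithinAt g (v t (g t)) (Icc b c) t) {t : ℝ} (ht : t ∈ Icc a c) :
    HasDerivWithinAt (fun t => if t ≤ b then f t else g t) (v t (if t ≤ b then f t else g t))
      (Icc a c) t := by
  set F : ℝ → E := fun t => if t ≤ b then f t else g t with hF
  have hFf : EqOn F f (Icc a b) := fun s hs => if_pos hs.2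
  have hFg : EqOn F g (Icc b c) := fun s hs => by
    obtain rfl | hs' := hs.1.eq_or_lt
    · exact (if_pos le_rfl).trans hfg
    · exact if_neg hs'.not_ge
  have hleft : t ∈ Icc a b → HasDerivWithinAt F (v t (F t)) (Icc a b) t := fun h =>
    hFf h ▸ (hf t h).congr_of_mem hFf h
  have hright : t ∈ Icc b c → HasDerivWithinAt F (v t (F t)) (Icc b c) t := fun h =>
    hFg h ▸ (hg t h).congr_of_mem hFg h
  rw [← Icc_union_Icc_eq_Icc hab hbc]
  obtain h | rfl | h := lt_trichotomy t b
  · refine (hleft ⟨ht.1, h.le⟩).mono_of_mem_nhdsWithin ?_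
    rw [Icc_union_Icc_eq_Icc hab hbc]
    filter_upwards [self_mem_nhdsWithin, mem_nhdsWithin_of_mem_nhds (Iio_mem_nhds h)]
      with s hs hs' using ⟨hs.1, le_of_lt hs'⟩
  · exact (hleft ⟨hab, le_rfl⟩).union (hright ⟨le_rfl, hbc⟩)
  · refine (hright ⟨h.le, ht.2⟩).mono_of_mem_nhdsWithin ?_
    rw [Icc_union_Icc_eq_Icc hab hbc]
    filter_upwards [self_mem_nhdsWithin, mem_nhdsWithin_of_mem_nhds (Ioi_mem_nhds h)]
      with s hs hs' using ⟨le_of_lt hs', hs.2⟩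

lemma exists_solution_of_lipschitzWith_of_le [CompleteSpace E] (hlip : ∀ t, LipschitzWith K (v t))
    (hcont : ∀ x, Continuous fun t => v t x) {a b : ℝ} (hab : a ≤ b)
    (hlen : (2 * K + 1) * (b - a) ≤ 1) (x₀ : E) :
    ∃ w : ℝ → E, w a = x₀ ∧ ∀ t ∈ Icc a b, HasDerivWithinAt w (v t (w t)) (Icc a b) t := by
  obtain ⟨M, hM⟩ := isCompact_Icc.exists_bound_of_continuousOn (hcont 0).continuousOn (s := Icc a b)
  have hM0 : 0 ≤ M := (norm_nonneg _).trans (hM a ⟨le_rfl, hab⟩)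
  -- A ball of this radius makes the time step independent of `x₀` and of `v t 0`.
  let R : NNReal := ⟨‖x₀‖ + M, by positivity⟩
  have hPL : IsPicardLindelof v (⟨a, le_rfl, hab⟩ : Icc a b) x₀ R 0 ((2 * K + 1) * R) K := by
    refine ⟨fun t _ => (hlip t).lipschitzOnWith, fun x _ => (hcont x).continuousOn,
      fun t ht x hx => ?_, ?_⟩
    · have hx' : ‖x‖ ≤ 2 * R := by
        have hdist : ‖x - x₀‖ ≤ R := mem_closedBall_iff_norm.1 hx
        have hx₀ : ‖x₀‖ ≤ R := le_add_of_nonneg_right hM0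
        linarith [norm_le_norm_add_norm_sub' x x₀]
      calc ‖v t x‖ ≤ ‖v t x - v t 0‖ + ‖v t 0‖ := norm_le_norm_sub_add _ _
        _ ≤ K * (2 * R) + R := by
          refine add_le_add ?_ ((hM t ht).trans (le_add_of_nonneg_left (norm_nonneg x₀)))
          exact ((hlip t).norm_sub_le x 0).trans (by rw [sub_zero]; gcongr)
        _ = ((2 * K + 1) * R : NNReal) := by push_cast; ring
    · have := mul_le_mul_of_nonneg_right hlen R.2
      simpa [hab, mul_right_comm] using this
  exact hPL.exists_eq_forall_mem_Icc_hasDerivWithinAt₀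

theorem exists_solution_of_lipschitzWith [CompleteSpace E] (hlip : ∀ t, LipschitzWith K (v t))
    (hcont : ∀ x, Continuous fun t => v t x) {a b : ℝ} (hab : a ≤ b) (x₀ : E) :
    ∃ w : ℝ → E, w a = x₀ ∧ ∀ t ∈ Icc a b, HasDerivWithinAt w (v t (w t)) (Icc a b) t := by
  obtain ⟨n, hn⟩ := exists_nat_ge ((2 * K + 1) * (b - a))
  induction n generalizing a x₀ with
  | zero =>
    exact exists_solution_of_lipschitzWith_of_le hlip hcont hab (by norm_num at hn; linarith) x₀
  | succ n ih =>
    have hK : (0 : ℝ) < 2 * K + 1 := by positivity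
    obtain hle | hlt := le_total b (a + (2 * K + 1 : ℝ)⁻¹)
    · refine exists_solution_of_lipschitzWith_of_le hlip hcont hab ?_ x₀
      rwa [← le_inv_mul_iff₀ hK, mul_one, sub_le_iff_le_add']
    · set c := a + (2 * K + 1 : ℝ)⁻¹ with hc
      have hac : a ≤ c := le_add_of_nonneg_right (by positivity)
      have hstep : (2 * K + 1) * (c - a) = 1 := by
        rw [hc, add_sub_cancel_left, mul_inv_cancel₀ hK.ne']
      obtain ⟨f, hfa, hf⟩ :=
        exists_solution_of_lipschitzWith_of_le hlip hcont hac hstep.le x₀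
      obtain ⟨g, hgc, hg⟩ := ih hlt (f c) (by push_cast at hn; linarith)
      exact ⟨fun t => if t ≤ c then f t else g t, (if_pos hac).trans hfa,
        fun t ht => hasDerivWithinAt_ite hac hlt hgc.symm hf hg ht⟩

variable {d : E → E} {L : NNReal} {a b : ℝ} {U : ℝ → E}

lemma hasDerivWithinAt_Ici_of_Icc {f : ℝ → E} {f' : E} {t : ℝ} (ht : t ∈ Ico a b)
    (hf : HasDerivWithinAt f f' (Icc a b) t) : HasDerivWithinAt f f' (Ici t) t :=
  hf.mono_of_mem_nhdsWithin (Icc_mem_nhdsGE_of_mem ht)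

lemma dist_le_gronwallBound_of_perturbation (hv : ∀ t, LipschitzWith K (v t))
    (hd : LipschitzWith L d) (hab : a ≤ b)
    (hU : ∀ t ∈ Icc a b, HasDerivWithinAt U (v t (U t)) (Icc a b) t) {R : ℝ}
    (hR : ∀ t ∈ Icc a b, ‖d (U t)‖ ≤ R) {ε : ℝ} (hε : ε ∈ Ioo (0 : ℝ) 1) {w : ℝ → E}
    (hw : ∀ t ∈ Icc a b, HasDerivWithinAt w (ε • d (w t) + v t (w t)) (Icc a b) t)
    (hwU : w a = U a) :
    dist (w b) (U b) ≤ gronwallBound 0 (L + K : NNReal) (0 + ε * R) (b - a) := by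
  have hlip (t : ℝ) : LipschitzWith (L + K) fun x => ε • d x + v t x := by
    refine LipschitzWith.add (LipschitzWith.of_dist_le_mul fun x y => ?_) (hv t)
    rw [dist_smul₀, Real.norm_of_nonneg hε.1.le]
    exact (mul_le_of_le_one_left dist_nonneg hε.2.le).trans (hd.dist_le_mul x y)
  refine dist_le_of_approx_trajectories_ODE hlip (fun t ht => (hw t ht).continuousWithinAt)
    (fun t ht => hasDerivWithinAt_Ici_of_Icc ht (hw t (Ico_subset_Icc_self ht)))
    (fun t _ => (dist_self _).le)
    (fun t ht => (hU t ht).continuousWithinAt)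
    (fun t ht => hasDerivWithinAt_Ici_of_Icc ht (hU t (Ico_subset_Icc_self ht))) (fun t ht => ?_)
    (by rw [hwU, dist_self]) b ⟨hab, le_rfl⟩
  rw [dist_eq_norm, sub_add_cancel_right, norm_neg, norm_smul, Real.norm_of_nonneg hε.1.le]
  exact mul_le_mul_of_nonneg_left (hR t (Ico_subset_Icc_self ht)) hε.1.le

theorem tendsto_of_perturbation (hv : ∀ t, LipschitzWith K (v t)) (hd : LipschitzWith L d)
    (hab : a ≤ b) (hU : ∀ t ∈ Icc a b, HasDerivWithinAt U (v t (U t)) (Icc a b) t)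
    {w : ℝ → ℝ → E}
    (hw : ∀ ε, ∀ t ∈ Icc a b, HasDerivWithinAt (w ε) (ε • d (w ε t) + v t (w ε t)) (Icc a b) t)
    (hwU : ∀ ε, w ε a = U a) :
    Filter.Tendsto (fun ε => w ε b) (𝓝[>] 0) (𝓝 (U b)) := by
  have hUcont : ContinuousOn U (Icc a b) := fun t ht => (hU t ht).continuousWithinAt
  obtain ⟨R, hR⟩ :=
    isCompact_Icc.exists_bound_of_continuousOn (hd.continuous.comp_continuousOn hUcont)
  rw [tendsto_iff_dist_tendsto_zero]
  refine squeeze_zero' (Filter.Eventually.of_forall fun _ => dist_nonneg) ?_ ?_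
    (g := fun ε => gronwallBound 0 (L + K : NNReal) (0 + ε * R) (b - a))
  · filter_upwards [Ioo_mem_nhdsGT one_pos] with ε hε
    exact dist_le_gronwallBound_of_perturbation hv hd hab hU hR hε (hw ε) (hwU ε)
  · have hcont : Continuous fun ε : ℝ =>
        gronwallBound 0 (L + K : NNReal) (0 + ε * R) (b - a) :=
      (gronwallBound_continuous_ε _ _ _).comp (by fun_prop)
    have hzero := hcont.tendsto 0
    simp only [zero_mul, add_zero, gronwallBound_ε0_δ0] at hzero
    exact hzero.mono_left nhdsWithin_le_nhds

end LipschitzODE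

section Perturbation

open Set

variable {𝔸 : Type*} [NormedRing 𝔸]

lemma lipschitzWith_mul_left (a : 𝔸) {C : NNReal} (ha : ‖a‖ ≤ C) :
    LipschitzWith C fun x => a * x :=
  LipschitzWith.of_dist_le_mul fun x y => by
    rw [dist_eq_norm, dist_eq_norm, ← mul_sub]
    exact (norm_mul_le _ _).trans (by gcongr)

variable [NormedAlgebra ℝ 𝔸] {E : Type*} [NormedAddCommGroup E] [NormedSpace ℝ E]
  {h : E →L[ℝ] 𝔸} {α : ℝ → E} {U : ℝ → 𝔸} {V : 𝔸}

lemma Steers.continuous_control (hU : Steers h α U V) : Continuous fun t => h (α t) :=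
  h.continuous.comp hU.contDiff.continuous

lemma Steers.exists_norm_le (hU : Steers h α U V) : ∃ C : NNReal, ∀ t, ‖h (α t)‖ ≤ C := by
  have hsupport : HasCompactSupport fun t => h (α t) := by
    refine HasCompactSupport.intro (isCompact_Icc (a := (0 : ℝ)) (b := 1)) fun t ht => ?_
    obtain ht0 | ht0 := le_total t 0
    · rw [hU.control_of_nonpos t ht0, map_zero]
    · rw [hU.control_of_one_le t (not_lt.1 fun ht1 => ht ⟨ht0, ht1.le⟩), map_zero]
  obtain ⟨C, hC⟩ := hU.continuous_control.bounded_above_of_compact_support hsupport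
  exact ⟨C.toNNReal, fun t => (hC t).trans (Real.le_coe_toNNReal C)⟩

theorem Steers.exists_perturbation [CompleteSpace 𝔸] (hU : Steers h α U V) (D : 𝔸) :
    ∃ w : ℝ → ℝ → 𝔸, (∀ T, w T 0 = 1) ∧
      (∀ T, ∀ t ∈ Icc (0 : ℝ) 1,
        HasDerivWithinAt (w T) ((T • D + h (α t)) * w T t) (Icc 0 1) t) ∧
      Filter.Tendsto (fun T => w T 1) (𝓝[>] 0) (𝓝 V) := by
  obtain ⟨C, hC⟩ := hU.exists_norm_le
  have hlip (T t : ℝ) : LipschitzWith (‖T • D‖₊ + C) fun x => (T • D + h (α t)) * x :=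
    lipschitzWith_mul_left _ ((norm_add_le _ _).trans (add_le_add le_rfl (hC t)))
  have hcont (T : ℝ) (x : 𝔸) : Continuous fun t => (T • D + h (α t)) * x :=
    (continuous_const.add hU.continuous_control).mul continuous_const
  choose w hw0 hw using fun T =>
    exists_solution_of_lipschitzWith (hlip T) (hcont T) zero_le_one (1 : 𝔸)
  refine ⟨w, hw0, hw, hU.of_one_le 1 le_rfl ▸ tendsto_of_perturbation
    (fun t => lipschitzWith_mul_left _ (hC t)) (lipschitzWith_mul_left D (coe_nnnorm D).ge)
    zero_le_one (fun t _ => (hU.hasDerivAt t).hasDerivWithinAt) (fun T t ht => ?_)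
    (fun T => (hw0 T).trans (hU.of_nonpos 0 le_rfl).symm)⟩
  exact (hw T t ht).congr_deriv (by rw [add_mul, smul_mul_assoc])

lemma div_mem_Icc {T t : ℝ} (hT : 0 < T) (ht : t ∈ Icc 0 T) : t / T ∈ Icc (0 : ℝ) 1 :=
  ⟨div_nonneg ht.1 hT.le, (div_le_one hT).2 ht.2⟩

lemma hasDerivWithinAt_comp_div {w : ℝ → E} {w' : E} {T t : ℝ} (hT : 0 < T)
    (hw : HasDerivWithinAt w w' (Icc 0 1) (t / T)) :
    HasDerivWithinAt (fun t => w (t / T)) (T⁻¹ • w') (Icc 0 T) t := by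
  have hdiv : HasDerivWithinAt (fun t : ℝ => t / T) T⁻¹ (Icc 0 T) t := by
    simpa using ((hasDerivAt_id t).div_const T).hasDerivWithinAt
  exact HasDerivWithinAt.scomp t hw hdiv fun s hs => div_mem_Icc hT hs

lemma speedUp_eq_smul (α : ℝ → ℂ) (T t : ℝ) : speedUp α T t = T⁻¹ • α (t / T) :=
  Complex.real_smul.symm

lemma contDiff_speedUp {n : WithTop ℕ∞} {α : ℝ → ℂ} (hα : ContDiff ℝ n α) (T : ℝ) :
    ContDiff ℝ n (speedUp α T) :=
  contDiff_const.mul (hα.comp (contDiff_id.div_const T))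

lemma hasDerivWithinAt_speedUp {h : ℂ →L[ℝ] 𝔸} {α : ℝ → ℂ} {D : 𝔸} {w : ℝ → 𝔸} {T : ℝ}
    (hT : 0 < T) (hw : ∀ t ∈ Icc (0 : ℝ) 1,
      HasDerivWithinAt w ((T • D + h (α t)) * w t) (Icc 0 1) t) {t : ℝ} (ht : t ∈ Icc 0 T) :
    HasDerivWithinAt (fun t => w (t / T)) ((D + h (speedUp α T t)) * w (t / T)) (Icc 0 T) t := by
  refine (hasDerivWithinAt_comp_div hT (hw _ (div_mem_Icc hT ht))).congr_deriv ?_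
  rw [speedUp_eq_smul, map_smul, ← smul_mul_assoc, smul_add, smul_smul, inv_mul_cancel₀ hT.ne',
    one_smul]

end Perturbation

/-! ### The blockade subspace -/

/-- The matrix element `⟨n+1| a† (n̂ - r) |n⟩ = √(n+1) (n - r)` of the blockade drive. It vanishes
at `n = r`, which decouples the levels `0, …, r` from the higher ones. -/
noncomputable def amp (r n : ℕ) : ℝ := Real.sqrt (n + 1) * ((n : ℝ) - r)

lemma amp_ne_zero {r n : ℕ} (h : n < r) : amp r n ≠ 0 :=
  mul_ne_zero (Real.sqrt_ne_zero'.2 (by positivity)) (sub_ne_zero.2 (by exact_mod_cast h.ne))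

lemma amp_mul_self (r n : ℕ) : amp r n * amp r n = (n + 1) * ((n : ℝ) - r) ^ 2 := by
  rw [amp, mul_mul_mul_comm, Real.mul_self_sqrt (by positivity), sq]

lemma create_single (n : ℕ) (z : ℂ) :
    create (Finsupp.single n z) = Finsupp.single (n + 1) (z * (Real.sqrt (n + 1) : ℝ)) := by
  rw [create, Finsupp.linearCombination_single, Finsupp.smul_single, smul_eq_mul]

lemma annihilate_single_zero (z : ℂ) : annihilate (Finsupp.single 0 z) = 0 := by
  simp [annihilate, Finsupp.linearCombination_single]

lemma annihilate_single_succ (n : ℕ) (z : ℂ) :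
    annihilate (Finsupp.single (n + 1) z) = Finsupp.single n (z * (Real.sqrt (n + 1) : ℝ)) := by
  simp [annihilate, Finsupp.linearCombination_single]

lemma number_single (n : ℕ) (z : ℂ) :
    number (Finsupp.single n z) = Finsupp.single n (z * n) := by
  obtain _ | n := n
  · simp [number, annihilate_single_zero]
  · rw [number, Module.End.mul_apply, annihilate_single_succ, create_single, mul_assoc,
      ← Complex.ofReal_mul, Real.mul_self_sqrt (by positivity)]
    norm_cast

lemma number_sub_smul_one_single (c : ℂ) (n : ℕ) (z : ℂ) :
    (number - c • 1) (Finsupp.single n z) = Finsupp.single n (z * (n - c)) := by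
  rw [LinearMap.sub_apply, number_single, LinearMap.smul_apply, Module.End.one_apply,
    Finsupp.smul_single, ← Finsupp.single_sub, smul_eq_mul, mul_sub, mul_comm c]

lemma drive_single (r n : ℕ) (z : ℂ) :
    drive r (Finsupp.single n z) = Finsupp.single (n + 1) (z * (amp r n : ℝ)) := by
  rw [drive, Module.End.mul_apply, number_sub_smul_one_single, create_single, amp]
  push_cast
  ring_nf

lemma driveAdj_single_zero (r : ℕ) (z : ℂ) : driveAdj r (Finsupp.single 0 z) = 0 := by
  rw [driveAdj, Module.End.mul_apply, annihilate_single_zero, map_zero]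

lemma driveAdj_single_succ (r n : ℕ) (z : ℂ) :
    driveAdj r (Finsupp.single (n + 1) z) = Finsupp.single n (z * (amp r n : ℝ)) := by
  rw [driveAdj, Module.End.mul_apply, annihilate_single_succ, number_sub_smul_one_single, amp]
  push_cast
  ring_nf

lemma compress_drive (r : ℕ) :
    compress r (drive r) = ∑ k : Fin r, Matrix.single k.succ k.castSucc (amp r k : ℂ) := by
  ext m n
  rw [compress, Matrix.of_apply, drive_single, one_mul, Matrix.sum_apply]
  induction n using Fin.lastCases with
  | last =>
    rw [Finsupp.single_apply, if_neg (by simp only [Fin.val_last]; omega)]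
    exact (Finset.sum_eq_zero fun k _ =>
      Matrix.single_apply_of_col_ne _ _ k.castSucc_lt_last.ne _).symm
  | cast n =>
    rw [Finset.sum_eq_single n (fun k _ hk => Matrix.single_apply_of_col_ne _ _
      (Fin.castSucc_injective r |>.ne hk) _) (by simp)]
    simp [Finsupp.single_apply, Matrix.single_apply, Fin.ext_iff]

lemma compress_driveAdj (r : ℕ) :
    compress r (driveAdj r) = ∑ k : Fin r, Matrix.single k.castSucc k.succ (amp r k : ℂ) := by
  ext m n
  rw [compress, Matrix.of_apply, Matrix.sum_apply]
  induction n using Fin.cases with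
  | zero =>
    rw [Fin.val_zero, driveAdj_single_zero]
    exact (Finset.sum_eq_zero fun k _ =>
      Matrix.single_apply_of_col_ne _ _ k.succ_ne_zero _).symm
  | succ n =>
    rw [Fin.val_succ, driveAdj_single_succ, one_mul,
      Finset.sum_eq_single n (fun k _ hk => Matrix.single_apply_of_col_ne _ _
        (Fin.succ_injective r |>.ne hk) _) (by simp)]
    simp [Finsupp.single_apply, Matrix.single_apply, Fin.ext_iff]

lemma controlR_eq (r : ℕ) : controlR r = compress r (drive r) + compress r (driveAdj r) := rfl

lemma controlI_eq (r : ℕ) : controlI r =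
    Complex.I • compress r (drive r) - Complex.I • compress r (driveAdj r) := by
  ext m n
  simp [controlI, compress]

lemma I_smul_controlR (r : ℕ) :
    Complex.I • controlR r = ∑ k : Fin r, hop k (Complex.I * amp r k) := by
  rw [controlR_eq, compress_drive, compress_driveAdj, ← Finset.sum_add_distrib, Finset.smul_sum]
  refine Finset.sum_congr rfl fun k _ => ?_
  rw [skew_apply, Complex.star_def, map_mul, Complex.conj_I, Complex.conj_ofReal, neg_mul,
    ← Matrix.single_neg, sub_neg_eq_add, smul_add, Matrix.smul_single, Matrix.smul_single,
    smul_eq_mul, add_comm]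

lemma I_smul_controlI (r : ℕ) : Complex.I • controlI r = ∑ k : Fin r, hop k (amp r k) := by
  rw [controlI_eq, ← smul_sub, smul_smul, Complex.I_mul_I, neg_one_smul, neg_sub, compress_drive,
    compress_driveAdj, ← Finset.sum_sub_distrib]
  exact Finset.sum_congr rfl fun k _ => by
    rw [skew_apply, Complex.star_def, Complex.conj_ofReal]

lemma sum_hop_mem_su {r : ℕ} (z : Fin r → ℂ) : ∑ k, hop k (z k) ∈ su (r + 1) :=
  sum_mem fun k _ => skew_mem_su k.castSucc_lt_succ.ne (z k)

lemma sum_single_mul_sum_single {ι n α : Type*} [Fintype ι] [Fintype n] [DecidableEq n]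
    [NonUnitalNonAssocSemiring α] (e : ι → n) {f : ι → n}
    (hf : Function.Injective f) (a b : ι → α) :
    (∑ k, Matrix.single (e k) (f k) (a k)) * ∑ k, Matrix.single (f k) (e k) (b k) =
      ∑ k, Matrix.single (e k) (e k) (a k * b k) := by
  rw [Finset.sum_mul_sum]
  refine Finset.sum_congr rfl fun k _ => ?_
  rw [Finset.sum_eq_single k
    (fun l _ hl => Matrix.single_mul_single_of_ne _ _ _ _ (hf.ne hl.symm) _) (by simp),
    Matrix.single_mul_single_same]

lemma compress_drive_mul_compress_driveAdj (r : ℕ) :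
    compress r (drive r) * compress r (driveAdj r) = Matrix.diagonal fun n : Fin (r + 1) =>
      ((n * ((n : ℝ) - 1 - r) ^ 2 : ℝ) : ℂ) := by
  rw [compress_drive, compress_driveAdj,
    sum_single_mul_sum_single _ (Fin.castSucc_injective r) _ _, ← Matrix.sum_single_eq_diagonal,
    Fin.sum_univ_succ]
  simp [← Complex.ofReal_mul, amp_mul_self]

lemma compress_driveAdj_mul_compress_drive (r : ℕ) :
    compress r (driveAdj r) * compress r (drive r) = Matrix.diagonal fun n : Fin (r + 1) =>
      ((((n : ℝ) + 1) * ((n : ℝ) - r) ^ 2 : ℝ) : ℂ) := by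
  rw [compress_drive, compress_driveAdj,
    sum_single_mul_sum_single _ (Fin.succ_injective r) _ _, ← Matrix.sum_single_eq_diagonal,
    Fin.sum_univ_castSucc]
  simp [← Complex.ofReal_mul, amp_mul_self]

/-- Writing `P = Π_r a† (n̂ - r) Π_r`, the two drives are `i (P + P†)` and `P† - P`, so their
commutator is `2 i [P, P†]`. -/
theorem lie_controlR_controlI (r : ℕ) :
    ⁅Complex.I • controlR r, Complex.I • controlI r⁆ = skewDiagonal (level r) := by
  have hlie (P Q : Op r) : ⁅Complex.I • (P + Q), Complex.I • (Complex.I • P - Complex.I • Q)⁆ =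
      (2 * Complex.I) • (P * Q - Q * P) := by
    rw [← smul_sub, smul_smul, Complex.I_mul_I, neg_one_smul, neg_sub, Ring.lie_def]
    simp only [smul_mul_assoc, mul_smul_comm, mul_sub, sub_mul, mul_add, add_mul]
    module
  rw [controlR_eq, controlI_eq, hlie, compress_drive_mul_compress_driveAdj,
    compress_driveAdj_mul_compress_drive, Matrix.diagonal_sub, ← Matrix.diagonal_smul, skewDiagonal]
  congr 1
  ext n
  simp only [Pi.smul_apply, smul_eq_mul, level]
  push_cast
  ring

lemma skewDiagonal_eq_sum_single {n : Type*} [Fintype n] [DecidableEq n] (F : n → ℝ) :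
    skewDiagonal F = ∑ l, ((F l : ℂ) * Complex.I) • Matrix.single l l (1 : ℂ) := by
  simp only [Matrix.smul_single, smul_eq_mul, mul_one, Matrix.sum_single_eq_diagonal,
    skewDiagonal, mul_comm]

theorem anharmonic_level {r : ℕ} (hr : 1 ≤ r) : Anharmonic (level r) := by
  have gap_level (k : Fin r) : gap (level r) k = 4 * (3 * (k : ℝ) + 1 - 2 * r) := by
    simp only [gap, level, Fin.val_castSucc, Fin.val_succ]
    push_cast
    ring
  have hr' : (1 : ℝ) ≤ r := by exact_mod_cast hr
  refine ⟨⟨0, hr⟩, Or.inl rfl, ?_, fun k hk h => ?_⟩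
  · rw [gap_level]
    simp only [Nat.cast_zero]
    linarith
  · have hk_pos : (0 : ℝ) < (k : ℕ) :=
      Nat.cast_pos.2 (Nat.pos_of_ne_zero fun h0 => hk (Fin.ext h0))
    have hk_lt : ((k : ℕ) : ℝ) + 1 ≤ r := by exact_mod_cast k.2
    rw [gap_level, gap_level] at h
    have : ((k : ℕ) : ℝ) * (3 * (k : ℕ) + 2 - 4 * r) = 0 := by
      simp only [Nat.cast_zero] at h
      linear_combination h / 48
    rcases mul_eq_zero.1 this with h | h <;> linarith

theorem lieSpan_lie_controlR {r : ℕ} (hr : 1 ≤ r) :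
    LieSubalgebra.lieSpan ℝ (Op r)
      {⁅Complex.I • controlR r, Complex.I • controlI r⁆, Complex.I • controlR r} = su (r + 1) := by
  have hR := I_smul_controlR r ▸ sum_hop_mem_su _
  have hI := I_smul_controlI r ▸ sum_hop_mem_su _
  apply le_antisymm
  · rw [LieSubalgebra.lieSpan_le]
    rintro A (rfl | rfl)
    exacts [(su (r + 1)).lie_mem hR hI, hR]
  · apply su_le_of_anharmonic (anharmonic_level hr) (z := fun k => Complex.I * amp r k)
    · rw [← lie_controlR_controlI]
      exact LieSubalgebra.subset_lieSpan (Set.mem_insert _ _)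
    · rw [← I_smul_controlR]
      exact LieSubalgebra.subset_lieSpan (Set.mem_insert_of_mem _ rfl)
    · exact fun k => mul_ne_zero Complex.I_ne_zero (Complex.ofReal_ne_zero.2 (amp_ne_zero k.2))

theorem lieSpan_controlR_controlI {r : ℕ} (hr : 1 ≤ r) :
    LieSubalgebra.lieSpan ℝ (Op r)
      {Complex.I • controlR r, Complex.I • controlI r} = su (r + 1) := by
  apply le_antisymm
  · rw [LieSubalgebra.lieSpan_le]
    rintro A (rfl | rfl)
    exacts [I_smul_controlR r ▸ sum_hop_mem_su _, I_smul_controlI r ▸ sum_hop_mem_su _]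
  · rw [← lieSpan_lie_controlR hr, LieSubalgebra.lieSpan_le]
    have hR := LieSubalgebra.subset_lieSpan (R := ℝ)
      (Set.mem_insert (Complex.I • controlR r) {Complex.I • controlI r})
    have hI := LieSubalgebra.subset_lieSpan (R := ℝ)
      (Set.mem_insert_of_mem (Complex.I • controlR r) (Set.mem_singleton (Complex.I • controlI r)))
    rintro A (rfl | rfl)
    exacts [LieSubalgebra.lie_mem _ hR hI, hR]

section Control

open scoped Matrix.Norms.Operator

variable {r : ℕ} {χ : ℝ}

/-- The generator `-i (χ Re α H_{c,R} + χ Im α H_{c,I})` of the driven evolution, as a real linear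
function of the control. -/
noncomputable def generator (r : ℕ) (χ : ℝ) : ℂ →L[ℝ] Op r :=
  Complex.reCLM.smulRight (-χ • Complex.I • controlR r) +
    Complex.imCLM.smulRight (-χ • Complex.I • controlI r)

lemma generator_apply (r : ℕ) (χ : ℝ) (α : ℂ) :
    generator r χ α = -Complex.I • control r χ α := by
  simp only [generator, control, add_apply,
    ContinuousLinearMap.smulRight_apply, Complex.reCLM_apply, Complex.imCLM_apply,
    ← Complex.coe_smul]
  push_cast
  module

lemma su_le_lieSpan_range_generator (hr : 1 ≤ r) (hχ : χ ≠ 0) :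
    su (r + 1) ≤ LieSubalgebra.lieSpan ℝ (Op r) (Set.range (generator r χ)) := by
  rw [← lieSpan_controlR_controlI hr, LieSubalgebra.lieSpan_le, Set.insert_subset_iff,
    Set.singleton_subset_iff]
  constructor
  · refine LieSubalgebra.subset_lieSpan ⟨((-χ⁻¹ : ℝ) : ℂ), ?_⟩
    simp [generator, smul_smul, hχ]
  · refine LieSubalgebra.subset_lieSpan ⟨((-χ⁻¹ : ℝ) : ℂ) * Complex.I, ?_⟩
    simp [generator, smul_smul, hχ]

theorem specialUnitaryGroup_le_reachable (hr : 1 ≤ r) (hχ : χ ≠ 0) :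
    Matrix.specialUnitaryGroup (Fin (r + 1)) ℂ ≤ reachable (generator r χ) := by
  intro V hV
  obtain ⟨A, hA, rfl⟩ := exists_mem_su_exp_eq hV
  exact exp_mem_reachable_of_mem_lieSpan (su_le_lieSpan_range_generator hr hχ hA)

lemma isPropagator_speedUp {α : ℝ → ℂ} {D : Op r} {w : ℝ → Op r} {T : ℝ} (hT : 0 < T)
    (hw0 : w 0 = 1) (hw : ∀ t ∈ Set.Icc (0 : ℝ) 1, HasDerivWithinAt w
      ((T • (-Complex.I • D) + generator r χ (α t)) * w t) (Set.Icc 0 1) t) :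
    IsPropagator (fun t => D + control r χ (speedUp α T t)) T fun t => w (t / T) := by
  refine ⟨by simp only [zero_div, hw0], fun t ht =>
    (hasDerivWithinAt_speedUp hT hw ht).congr_deriv ?_⟩
  change (-Complex.I • D + generator r χ (speedUp α T t)) * w (t / T) = _
  rw [generator_apply, ← smul_add, smul_mul_assoc]

lemma Steers.exists_isPropagator {α : ℝ → ℂ} {U : ℝ → Op r} {V : Op r} {T : ℝ}
    (hU : Steers (generator r χ) α U V) (hT : 0 < T) :
    ∃ W : ℝ → Op r, IsPropagator (fun t => control r χ (speedUp α T t)) T W ∧ W T = V := by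
  refine ⟨fun t => U (t / T), ?_, hU.of_one_le _ (div_self hT.ne').ge⟩
  have hdriven := isPropagator_speedUp (D := 0) hT (hU.of_nonpos 0 le_rfl) fun t _ => by
    rw [smul_zero, smul_zero, zero_add]
    exact (hU.hasDerivAt t).hasDerivWithinAt
  simpa only [zero_add] using hdriven

lemma Steers.exists_isPropagator_tendsto {α : ℝ → ℂ} {U : ℝ → Op r} {V : Op r}
    (hU : Steers (generator r χ) α U V) (D : Op r) :
    ∃ W : ℝ → ℝ → Op r,
      (∀ T : ℝ, 0 < T → IsPropagator (fun t => D + control r χ (speedUp α T t)) T (W T)) ∧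
      Filter.Tendsto (fun T => W T T) (𝓝[>] 0) (𝓝 V) := by
  obtain ⟨w, hw0, hw, hlim⟩ := hU.exists_perturbation (-Complex.I • D)
  refine ⟨fun T t => w T (t / T), fun T hT => isPropagator_speedUp hT (hw0 T) (hw T),
    hlim.congr' ?_⟩
  filter_upwards [self_mem_nhdsWithin] with T hT
  rw [div_self (ne_of_gt hT)]

theorem exists_isPropagator_speedUp (hr : 1 ≤ r) (hχ : χ ≠ 0) (D : Op r) {V : Op r}
    (hV : V ∈ Matrix.specialUnitaryGroup (Fin (r + 1)) ℂ) :
    ∃ α : ℝ → ℂ, ContDiff ℝ ∞ α ∧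
      (∀ T : ℝ, 0 < T → ∃ U : ℝ → Op r,
        IsPropagator (fun t => control r χ (speedUp α T t)) T U ∧ U T = V) ∧
      ∃ W : ℝ → ℝ → Op r,
        (∀ T : ℝ, 0 < T → IsPropagator (fun t => D + control r χ (speedUp α T t)) T (W T)) ∧
        Filter.Tendsto (fun T => W T T) (𝓝[>] 0) (𝓝 V) := by
  obtain ⟨α, U, hU⟩ := specialUnitaryGroup_le_reachable hr hχ hV
  exact ⟨α, hU.contDiff, fun T hT => hU.exists_isPropagator hT, hU.exists_isPropagator_tendsto D⟩

end Control

end KerrBlockade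

open KerrBlockade in
/-- Commutator of the two control terms, generation of `𝔰𝔲(r+1)`, and control in arbitrarily short
time, in the `(r+1)`-dimensional blockade subspace of a Kerr oscillator. In the last part one
control shape `α`, sped up with growing amplitude, reaches `V` exactly in every time `T > 0` when
there is no drift, and in the limit `T → 0` when the drift is present. -/
theorem mainTheorem2 (r : ℕ) (hr : 1 ≤ r) :
    ⁅Complex.I • controlR r, Complex.I • controlI r⁆ =
        ∑ n : Fin (r + 1), ((level r n : ℂ) * Complex.I) • Matrix.single n n (1 : ℂ) ∧
      (⁅Complex.I • controlR r, Complex.I • controlI r⁆).trace = 0 ∧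
      (⁅Complex.I • controlR r, Complex.I • controlI r⁆).IsDiag ∧
      Anharmonic (level r) ∧
      LieSubalgebra.lieSpan ℝ (Op r)
        {⁅Complex.I • controlR r, Complex.I • controlI r⁆, Complex.I • controlR r} = su (r + 1) ∧
      LieSubalgebra.lieSpan ℝ (Op r)
        {Complex.I • controlR r, Complex.I • controlI r} = su (r + 1) ∧
      (∀ χ : ℝ, χ ≠ 0 → ∀ V ∈ Matrix.specialUnitaryGroup (Fin (r + 1)) ℂ, ∀ T : ℝ, 0 < T →
        ∃ α : ℝ → ℂ, ContDiff ℝ ∞ α ∧ ∃ U : ℝ → Op r,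
          IsPropagator (fun t => control r χ (α t)) T U ∧ U T = V) ∧
      (∀ χ Δ₀ : ℝ, χ ≠ 0 → ∀ V ∈ Matrix.specialUnitaryGroup (Fin (r + 1)) ℂ,
        ∃ α : ℝ → ℂ, ContDiff ℝ ∞ α ∧
          (∀ T : ℝ, 0 < T → ∃ U : ℝ → Op r,
            IsPropagator (fun t => control r χ (speedUp α T t)) T U ∧ U T = V) ∧
          ∃ W : ℝ → ℝ → Op r,
            (∀ T : ℝ, 0 < T → IsPropagator
              (fun t => drift r χ Δ₀ + control r χ (speedUp α T t)) T (W T)) ∧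
            Filter.Tendsto (fun T => W T T) (𝓝[>] 0) (𝓝 V)) := by
  refine ⟨?_, ?_, ?_, anharmonic_level hr, lieSpan_lie_controlR hr, lieSpan_controlR_controlI hr,
    fun χ hχ V hV T hT => ?_, fun χ Δ₀ hχ V hV =>
      exists_isPropagator_speedUp hr hχ (drift r χ Δ₀) hV⟩
  · rw [lie_controlR_controlI, skewDiagonal_eq_sum_single]
  · rw [Ring.lie_def, Matrix.trace_sub, Matrix.trace_mul_comm, sub_self]
  · exact lie_controlR_controlI r ▸ Matrix.isDiag_diagonal _
  · obtain ⟨α, hα, hU, -⟩ := exists_isPropagator_speedUp hr hχ 0 hV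
    exact ⟨speedUp α T, contDiff_speedUp hα T, hU T hT⟩
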